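/- For an even integer $d\ge 2$ put $k=d^2(d-1)$ and $m=k^2$. Let $\mathcal G_d$ be the graph obtained from the $d^3\times d^3$ square grid, divided into $d^4$ contiguous boxes of $d\times d$ grid points, by placing a control vertex at the centre of every $1\times1$ square contained in a box and joining it to the four corners of that square; the control vertices are denoted $u_{ij}$, $1\le i,j\le k$, where $i$ and $j$ give the horizontal and the vertical position. Let $\overline{\mathcal G}_d$ be the graph obtained from $\mathcal G_d$ by inserting one vertex at the middle of each edge, and let $n$ be its number of vertices. The graph state of $\overline{\mathcal G}_d$ is the state of $n$ qubits, one per vertex, obtained from $|0\rangle^{\otimes n}$ by applying a Hadamard gate to each qubit and then a Controlled-$Z$ gate to each pair of adjacent vertices. For $A\in\{0,1\}^{k\times k}$ let $\Lambda_d(A)\subseteq\{0,1\}^n$ be the set of outcome strings that have positive probability when, in the graph state of $\overline{\mathcal G}_d$, the qubit of each $u_{ij}$ with $A_{ij}=1$ is measured in the $Y$-basis and all other qubits are measured in the $X$-basis (outcomes $0$ and $1$ stand for the eigenvalues $1$ and $-1$). Let $R_d=\{(A,z) : z\in\Lambda_d(A)\}\subseteq\{0,1\}^{m}\times\{0,1\}^n$,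 and $R_d(A)=\Lambda_d(A)$. Then the following two assertions hold. 1. There is a constant $D$ such that for every even $d\ge2$ there is a quantum circuit of depth at most $D$, with gates acting on at most two qubits each, that on every input $A\in\{0,1\}^{m}$ outputs a string in $R_d(A)$ with probability $1$. 2. There is a constant $d_0$ such that for every even $d\ge d_0$ and every integer $K\ge2$, every randomized classical circuit $C$ with gates of fanin at most $K$ and of depth at most $\frac18\log_K m$ satisfies $$\frac1{2^m}\sum_{A\in\{0,1\}^m}\Pr[C(A)\in R_d(A)]<\frac{15}{16}.$$ In particular (with $\alpha=1/16$), for each fixed fanin bound, randomized circuits whose average success probability is at least $1-\alpha$ have depth $\Omega(\log m)$; for fanin at most $2$ it exceeds $\frac18\log_2 m$. -/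

import Mathlib

namespace ShallowCircuits

/-! ## Classical circuits -/

/-- A Boolean circuit with input wires labelled by `ι` and output wires labelled by `o`: a directed
acyclic graph whose gates are listed in a topological order. Each gate computes an arbitrary
Boolean function of its predecessors (inputs or earlier gates); there is no restriction on the
fanout or on the number of gates. -/
structure BoolCircuit (ι o : Type) where
  /-- number of gates -/
  size : ℕ
  /-- fanin of each gate -/
  fanin : Fin size → ℕ
  /-- sources of the incoming wires of each gate -/
  src : (g : Fin size) → Fin (fanin g) → ι ⊕ {h : Fin size // h < g}
  /-- Boolean function computed by each gate -/
  op : (g : Fin size) → (Fin (fanin g) → Bool) → Bool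
  /-- the input or gate from which each output is taken -/
  out : o → ι ⊕ Fin size

namespace BoolCircuit

variable {ι o : Type}

/-- Value of a gate on a given input. -/
def gateVal (C : BoolCircuit ι o) (x : ι → Bool) (g : Fin C.size) : Bool :=
  C.op g fun j => match C.src g j with
    | Sum.inl i => x i
    | Sum.inr h => C.gateVal x h.1
termination_by g
decreasing_by exact h.2

/-- Output of the circuit on a given input. -/
def eval (C : BoolCircuit ι o) (x : ι → Bool) : o → Bool := fun a =>
  match C.out a with
  | Sum.inl i => x i
  | Sum.inr g => C.gateVal x g

/-- Depth of a gate: the largest number of gates on a path ending with that gate. -/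
def gateDepth (C : BoolCircuit ι o) (g : Fin C.size) : ℕ :=
  1 + Finset.univ.sup fun j => match C.src g j with
    | Sum.inl _ => 0
    | Sum.inr h => C.gateDepth h.1
termination_by g
decreasing_by exact h.2

/-- Depth of the circuit: the largest number of gates on a path ending at an output. -/
def depth [Fintype o] (C : BoolCircuit ι o) : ℕ :=
  Finset.univ.sup fun a => match C.out a with
    | Sum.inl _ => 0
    | Sum.inr g => C.gateDepth g

/-- All gates have fanin at most `K`. -/
def FaninLE (C : BoolCircuit ι o) (K : ℕ) : Prop := ∀ g, C.fanin g ≤ K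

end BoolCircuit

/-- A randomized circuit: a Boolean circuit that receives, besides its input, a random string of
`rand` bits. The string may follow any distribution; independent uniform bits are one case. -/
structure RandCircuit (ι o : Type) where
  /-- number of random bits -/
  rand : ℕ
  /-- distribution of the random string -/
  dist : PMF (Fin rand → Bool)
  /-- the underlying deterministic circuit -/
  circuit : BoolCircuit (ι ⊕ Fin rand) o

open Classical in
/-- `Pr[C(x) ∈ S]`, over the random string of the circuit. -/
noncomputable def RandCircuit.prob {ι o : Type} (C : RandCircuit ι o) (x : ι → Bool)
    (S : Set (o → Bool)) : ℝ :=
  ∑ r : Fin C.rand → Bool, if C.circuit.eval (Sum.elim x r) ∈ S then (C.dist r).toReal else 0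

/-! ## Qubits and quantum circuits

The states of qubits labelled by `Q` are vectors indexed by the computational basis `Q → Bool`,
with `false` for `|0⟩` and `true` for `|1⟩`. -/

/-- The computational basis state `|b⟩`. -/
noncomputable def ket {Q : Type} [DecidableEq Q] [Fintype Q] (b : Q → Bool) : (Q → Bool) → ℂ :=
  Pi.single b 1

/-- A quantum gate: a unitary acting on the qubits in `support`. -/
structure QGate (Q : Type) [DecidableEq Q] where
  /-- qubits on which the gate acts -/
  support : Finset Q
  /-- matrix of the gate -/
  mat : Matrix (support → Bool) (support → Bool) ℂ
  /-- the matrix is unitary -/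
  unitary : mat ∈ Matrix.unitaryGroup (support → Bool) ℂ

/-- The operator of a gate on all qubits: the gate tensored with the identity elsewhere. -/
def QGate.toMatrix {Q : Type} [DecidableEq Q] [Fintype Q] (g : QGate Q) :
    Matrix (Q → Bool) (Q → Bool) ℂ :=
  fun x y => if ∀ q, q ∉ g.support → x q = y q then
    g.mat (fun q => x q) (fun q => y q) else 0

/-- A layer: gates acting on pairwise disjoint sets of qubits, applied in parallel. -/
structure QLayer (Q : Type) [DecidableEq Q] where
  /-- the gates of the layer -/
  gates : List (QGate Q)
  /-- the gates act on disjoint sets of qubits -/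
  disjoint : gates.Pairwise fun g h => Disjoint g.support h.support

/-- The operator of a layer (its gates commute). -/
def QLayer.toMatrix {Q : Type} [DecidableEq Q] [Fintype Q] (L : QLayer Q) :
    Matrix (Q → Bool) (Q → Bool) ℂ :=
  (L.gates.map QGate.toMatrix).prod

/-- A quantum circuit on `width` qubits with classical input bits labelled by `ι` and output bits
labelled by `o`. The input bits are written on distinct qubits, all other qubits start
in `|0⟩`, the layers are applied in the order of the list, and distinct output qubits are then
measured in the computational basis. -/
structure QCircuit (ι o : Type) where
  /-- number of qubits -/
  width : ℕ
  /-- input qubits -/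
  input : ι ↪ Fin width
  /-- output qubits -/
  output : o ↪ Fin width
  /-- layers of gates, the first one first -/
  layers : List (QLayer (Fin width))

namespace QCircuit

variable {ι o : Type}

/-- Depth: number of layers. -/
def depth (C : QCircuit ι o) : ℕ := C.layers.length

/-- All gates act on at most `K` qubits. -/
def FaninLE (C : QCircuit ι o) (K : ℕ) : Prop :=
  ∀ L ∈ C.layers, ∀ g ∈ L.gates, g.support.card ≤ K

open Classical in
/-- Initial contents of the qubits on input `x`. -/
noncomputable def initial (C : QCircuit ι o) (x : ι → Bool) : Fin C.width → Bool :=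
  fun q => if h : ∃ i, C.input i = q then x h.choose else false

/-- State of the qubits just before the final measurement, on input `x`. -/
noncomputable def final (C : QCircuit ι o) (x : ι → Bool) : (Fin C.width → Bool) → ℂ :=
  C.layers.foldl (fun ψ L => L.toMatrix.mulVec ψ) (ket (C.initial x))

open Classical in
/-- Probability that the output on input `x` belongs to `S`. -/
noncomputable def prob (C : QCircuit ι o) (x : ι → Bool) (S : Set (o → Bool)) : ℝ :=
  ∑ y : Fin C.width → Bool, if (fun a => y (C.output a)) ∈ S then ‖C.final x y‖ ^ 2 else 0

end QCircuit

/-! ## Graph states and their measurements -/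

/-- The Hadamard gate. -/
noncomputable def hadamard : Matrix Bool Bool ℂ :=
  fun a b => (1 / Real.sqrt 2 : ℝ) * (if a && b then -1 else 1)

/-- The gate `(1/√2) [[1, -i], [1, i]]`, which turns a measurement in the Y-basis into a
measurement in the computational basis. -/
noncomputable def yGate : Matrix Bool Bool ℂ :=
  fun a b => (1 / Real.sqrt 2 : ℝ) *
    (if b then (if a then Complex.I else -Complex.I) else 1)

/-- The tensor product of one-qubit operators. -/
def tensorOp {Q : Type} [Fintype Q] (U : Q → Matrix Bool Bool ℂ) :
    Matrix (Q → Bool) (Q → Bool) ℂ :=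
  fun x y => ∏ q, U q (x q) (y q)

/-- The diagonal entry at `x` of the Controlled-Z gate on the two endpoints of `e`. -/
def czPhase {Q : Type} [Fintype Q] [DecidableEq Q] (e : Sym2 Q) (x : Q → Bool) : ℂ :=
  if ∀ q ∈ e, x q = true then -1 else 1

/-- The graph state of `G`: Hadamard gates applied to all qubits of `|0…0⟩`, then a Controlled-Z
gate for each edge. The Controlled-Z gates are diagonal, so their product is the diagonal operator
with the products of their entries. -/
noncomputable def graphState {V : Type} [Fintype V] [DecidableEq V] (G : SimpleGraph V)
    [DecidableRel G.Adj] : (V → Bool) → ℂ :=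
  (Matrix.diagonal fun x => ∏ e ∈ G.edgeFinset, czPhase e x).mulVec
    ((tensorOp fun _ => hadamard).mulVec (ket fun _ => false))

/-- Probability of the outcome string `z` when every qubit `q` of the state `ψ` is measured, in the
Y-basis if `f q` is true and in the X-basis otherwise. -/
noncomputable def measureProb {Q : Type} [Fintype Q] [DecidableEq Q] (ψ : (Q → Bool) → ℂ) (f : Q → Bool)
    (z : Q → Bool) : ℝ :=
  ‖(tensorOp fun q => if f q then yGate else hadamard).mulVec ψ z‖ ^ 2

/-! ## The extended grid graph and the relation -/

/-- The extended graph of `G`: a vertex is inserted at the middle of each edge of `G`. -/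
def extendedGraph {V : Type} (G : SimpleGraph V) : SimpleGraph (V ⊕ G.edgeSet) where
  Adj a b := match a, b with
    | Sum.inl v, Sum.inr e => v ∈ e.1
    | Sum.inr e, Sum.inl v => v ∈ e.1
    | _, _ => False
  symm := ⟨by rintro (a | a) (b | b) h <;> exact h⟩
  loopless := ⟨by rintro (a | a) h <;> exact h⟩

instance {V : Type} [DecidableEq V] (G : SimpleGraph V) : DecidableRel (extendedGraph G).Adj
  | Sum.inl _, Sum.inl _ => isFalse id
  | Sum.inl v, Sum.inr e => inferInstanceAs (Decidable (v ∈ e.1))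
  | Sum.inr e, Sum.inl v => inferInstanceAs (Decidable (v ∈ e.1))
  | Sum.inr _, Sum.inr _ => isFalse id

/-- The side length `k = d²(d-1)` of the array of control vertices (`d ≥ 1`). -/
def ctrlSide (d : ℕ) : ℕ := d ^ 2 * (d - 1)

/-- Vertices of the grid graph with control vertices: the `d³ × d³` grid points, and the control
vertices `u_{ij}`. -/
abbrev GridVertex (d : ℕ) : Type :=
  (Fin (d ^ 3) × Fin (d ^ 3)) ⊕ (Fin (ctrlSide d) × Fin (ctrlSide d))

/-- Smaller coordinate of the unit square containing the control vertex of index `i` along one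
axis: with indices from `0`, boxes are intervals of `d` grid coordinates and each contains `d-1`
consecutive control indices. -/
def cellCoord (d i : ℕ) : ℕ := d * (i / (d - 1)) + i % (d - 1)

/-- The grid point `p` is a corner of the unit square centred at the control vertex `u`. -/
def IsCorner (d : ℕ) (p : Fin (d ^ 3) × Fin (d ^ 3))
    (u : Fin (ctrlSide d) × Fin (ctrlSide d)) : Prop :=
  ((p.1 : ℕ) = cellCoord d u.1 ∨ (p.1 : ℕ) = cellCoord d u.1 + 1) ∧
  ((p.2 : ℕ) = cellCoord d u.2 ∨ (p.2 : ℕ) = cellCoord d u.2 + 1)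

instance (d : ℕ) (p : Fin (d ^ 3) × Fin (d ^ 3)) (u : Fin (ctrlSide d) × Fin (ctrlSide d)) :
    Decidable (IsCorner d p u) := by unfold IsCorner; infer_instance

/-- The `d³ × d³` grid, in which each unit square contained in one of the `d⁴` boxes of `d × d` grid
points carries at its centre a control vertex joined to the four corners of the square. -/
def gridGraph (d : ℕ) : SimpleGraph (GridVertex d) where
  Adj a b := match a, b with
    | Sum.inl p, Sum.inl q =>
        Nat.dist p.1 q.1 + Nat.dist p.2 q.2 = 1
    | Sum.inl p, Sum.inr u => IsCorner d p u
    | Sum.inr u, Sum.inl p => IsCorner d p u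
    | Sum.inr _, Sum.inr _ => False
  symm := ⟨by
    rintro (a | a) (b | b) h
    · show Nat.dist b.1 a.1 + Nat.dist b.2 a.2 = 1
      rw [Nat.dist_comm, Nat.dist_comm (b.2 : ℕ)]; exact h
    all_goals exact h⟩
  loopless := ⟨by
    rintro (a | a) h
    · change Nat.dist a.1 a.1 + Nat.dist a.2 a.2 = 1 at h
      simp at h
    · exact h⟩

instance (d : ℕ) : DecidableRel (gridGraph d).Adj
  | Sum.inl p, Sum.inl q =>
      inferInstanceAs (Decidable (Nat.dist p.1 q.1 + Nat.dist p.2 q.2 = 1))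
  | Sum.inl p, Sum.inr u => inferInstanceAs (Decidable (IsCorner d p u))
  | Sum.inr u, Sum.inl p => inferInstanceAs (Decidable (IsCorner d p u))
  | Sum.inr _, Sum.inr _ => isFalse id

/-- Positions of the `m = k²` input bits: the entries of a `k × k` matrix. -/
abbrev InIdx (d : ℕ) : Type := Fin (ctrlSide d) × Fin (ctrlSide d)

/-- Positions of the `n` output bits: the vertices of the extended grid graph. -/
abbrev OutIdx (d : ℕ) : Type := GridVertex d ⊕ (gridGraph d).edgeSet

/-- The choice of bases given by the bit-matrix `A`: the Y-basis at the control vertices `u_{ij}`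
with `A_{ij} = 1`, the X-basis at all other vertices. -/
def basisChoice (d : ℕ) (A : InIdx d → Bool) : OutIdx d → Bool
  | Sum.inl (Sum.inr u) => A u
  | _ => false

/-- Outcome strings of positive probability when the graph state of the extended grid graph is
measured in the bases given by `A`. -/
def validOutcomes (d : ℕ) (A : InIdx d → Bool) : Set (OutIdx d → Bool) :=
  {z | 0 < measureProb (graphState (extendedGraph (gridGraph d))) (basisChoice d A) z}

/-- The relation `R_d`. -/
def rel (d : ℕ) : Set ((InIdx d → Bool) × (OutIdx d → Bool)) :=
  {p | p.2 ∈ validOutcomes d p.1}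

/-- `R(x) = {z | (x, z) ∈ R}`. -/
def answers {X Z : Type} (R : Set (X × Z)) (x : X) : Set Z := {z | (x, z) ∈ R}

end ShallowCircuits

open ShallowCircuits

/-! Parity conditions. An $X$-measurement of the middle qubit of an edge $vw$ forces its outcome to
be $y_v+y_w$ for some bit string $y$ on the original vertices. If $A$ has even weight $2t$,
complementing $y$ changes the amplitude only by a sign, and the two terms survive together only if
$\sum_v z_v+\sum_u A_u y_u+t$ is even (`exists_potential_of_measureProb_pos`).

Classical failure. With the random string fixed, each output depends on at most
$l=K^{\mathrm{depth}}\le k^{1/4}$ inputs. Counting interacting pairs yields inputs $a,b,c$ such that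
no output sees two of them and any two of their vertices are joined by a path whose edge outputs
ignore the third input. Fix all other inputs. The differences $y_a+y_b$, $y_a+y_c$, $y_b+y_c$ are
sums of edge outputs along these paths, so each ignores one of the three bits; since the weight is
even, $\sum_u A_u y_u$ involves only differences. Adding the parity conditions over the four
settings of the three bits with even total weight cancels every output contribution, while the four
values of $t$ have odd sum. This is the GHZ paradox (`parity_system_unsolvable`,
`exists_parity_violation`). Hence at least one setting in eight fails and the average success is at
most $7/8<15/16$.

Quantum success. The graph state is prepared and measured directly. The edges of the extended graph
are coloured by the displacement from the original vertex to the far end of its edge; each colour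
class is a matching, so 25 layers of Controlled-$Z$ gates suffice, between a Hadamard layer and one
layer of basis changes controlled by the input (`exists_quantum_circuit`). -/

namespace ShallowCircuits

/-! ## Outcomes of measurements of graph states of extended graphs -/

section GraphStates

variable {V : Type} [Fintype V] [DecidableEq V]

/-- The sign `(-1)^b`. -/
def boolSign (b : Bool) : ℂ := if b then -1 else 1

theorem boolSign_not (b : Bool) : boolSign (!b) = -boolSign b := by
  cases b <;> simp [boolSign]

theorem graphState_apply (G : SimpleGraph V) [DecidableRel G.Adj] (x : V → Bool) :
    graphState G x =
      (∏ e ∈ G.edgeFinset, czPhase e x) * ∏ _q : V, ((1 / Real.sqrt 2 : ℝ) : ℂ) := by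
  unfold graphState
  rw [Matrix.mulVec_diagonal]
  congr 1
  simp [ket, tensorOp, hadamard, Matrix.mulVec_single]

/-- The edges of the extended graph are the incident pairs of an edge and a vertex. -/
theorem prod_extendedGraph_edges (G : SimpleGraph V) [DecidableRel G.Adj]
    (g : Sym2 (V ⊕ G.edgeSet) → ℂ) :
    ∏ e ∈ (extendedGraph G).edgeFinset, g e =
      ∏ p ∈ (Finset.univ : Finset (G.edgeSet × V)).filter (fun p => p.2 ∈ p.1.1),
        g s(Sum.inl p.2, Sum.inr p.1) := by
  symm
  refine Finset.prod_bij (fun p _ => s(Sum.inl p.2, Sum.inr p.1)) ?_ ?_ ?_ ?_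
  · rintro ⟨e, v⟩ h
    simp only [Finset.mem_filter, Finset.mem_univ, true_and] at h
    rw [SimpleGraph.mem_edgeFinset, SimpleGraph.mem_edgeSet]
    exact h
  · rintro ⟨e, v⟩ _ ⟨e', v'⟩ _ h
    simpa [and_comm] using h
  · intro s
    induction s using Sym2.ind with
    | _ a b =>
      intro h
      rw [SimpleGraph.mem_edgeFinset, SimpleGraph.mem_edgeSet] at h
      rcases a with v | e <;> rcases b with w | e'
      · exact h.elim
      · exact ⟨(e', v), Finset.mem_filter.mpr ⟨Finset.mem_univ _, h⟩, rfl⟩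
      · exact ⟨(e, w), Finset.mem_filter.mpr ⟨Finset.mem_univ _, h⟩, Sym2.eq_swap⟩
      · exact h.elim
  · intros; rfl

theorem prod_czPhase_extendedGraph (G : SimpleGraph V) [DecidableRel G.Adj]
    (x : V ⊕ G.edgeSet → Bool) :
    ∏ e ∈ (extendedGraph G).edgeFinset, czPhase e x =
      ∏ e : G.edgeSet, if x (Sum.inr e) then
        ∏ v : V, if v ∈ e.1 then boolSign (x (Sum.inl v)) else 1 else 1 := by
  rw [prod_extendedGraph_edges, Finset.prod_filter, Fintype.prod_prod_type]
  refine Finset.prod_congr rfl fun e _ => ?_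
  cases hx : x (Sum.inr e)
  · simp [czPhase, hx]
  · simp [czPhase, hx, boolSign]

theorem prod_mem_edge (G : SimpleGraph V) (e : G.edgeSet) {v w : V} (h : e.1 = s(v, w))
    (g : V → ℂ) :
    ∏ u : V, (if u ∈ e.1 then g u else 1) = g v * g w := by
  have hvw : v ≠ w := by
    have := e.2; rw [h, SimpleGraph.mem_edgeSet] at this; exact this.ne
  rw [← Finset.prod_filter, ← Finset.prod_pair hvw]
  congr 1
  ext u
  simp [h]

/-- The amplitude of an outcome after summing over the qubits in the middle of the edges. -/
theorem amplitude_extendedGraph (G : SimpleGraph V) [DecidableRel G.Adj]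
    (U : V ⊕ G.edgeSet → Matrix Bool Bool ℂ)
    (z : V ⊕ G.edgeSet → Bool) :
    (tensorOp U).mulVec (graphState (extendedGraph G)) z =
      (∑ x : V → Bool, (∏ v, U (Sum.inl v) (z (Sum.inl v)) (x v)) *
        ∏ e : G.edgeSet, ∑ b : Bool, U (Sum.inr e) (z (Sum.inr e)) b *
          (if b then ∏ v : V, if v ∈ e.1 then boolSign (x v) else 1 else 1)) *
        ∏ _q : V ⊕ G.edgeSet, ((1 / Real.sqrt 2 : ℝ) : ℂ) := by
  simp only [Matrix.mulVec, dotProduct, graphState_apply, ← mul_assoc, ← Finset.sum_mul]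
  congr 1
  rw [← (Equiv.sumArrowEquivProdArrow V G.edgeSet Bool).symm.sum_comp, Fintype.sum_prod_type]
  refine Finset.sum_congr rfl fun x _ => ?_
  -- Middle qubits are pairwise nonadjacent, so for fixed `x` on the original vertices the sum over
  -- them factors edge by edge.
  rw [Finset.prod_univ_sum, Fintype.piFinset_univ, Finset.mul_sum]
  refine Finset.sum_congr rfl fun t _ => ?_
  rw [prod_czPhase_extendedGraph, tensorOp, Fintype.prod_sum_type, mul_assoc,
    Finset.prod_mul_distrib]
  rfl

/-- The ratio of the entries of the measurement operators at complementary basis states. -/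
theorem measureOp_not (f z y : Bool) :
    (if f then yGate else hadamard) z (!y) = (if f then yGate else hadamard) z y *
      ((-1) ^ (z.toNat + (if f then y.toNat else 0)) * (-Complex.I) ^ (if f then 1 else 0)) := by
  cases f <;> cases z <;> cases y <;>
    simp [hadamard, yGate] <;> ring_nf <;> simp

/-- Parity conditions satisfied by every outcome of positive probability. -/
theorem exists_potential_of_measureProb_pos (G : SimpleGraph V) [DecidableRel G.Adj]
    (f z : V ⊕ G.edgeSet → Bool)
    (hf : ∀ e, f (Sum.inr e) = false)
    (hz : 0 < measureProb (graphState (extendedGraph G)) f z) :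
    ∃ y : V → Bool,
      (∀ (e : G.edgeSet) (v w : V), e.1 = s(v, w) → z (Sum.inr e) = xor (y v) (y w)) ∧
      ∀ t : ℕ, ∑ v, (f (Sum.inl v)).toNat = 2 * t →
        Even (∑ v, (z (Sum.inl v)).toNat +
          ∑ v, (if f (Sum.inl v) then (y v).toNat else 0) + t) := by
  have h0 : (tensorOp fun q => if f q then yGate else hadamard).mulVec
      (graphState (extendedGraph G)) z ≠ 0 := by
    intro h
    simp [measureProb, h] at hz
  rw [amplitude_extendedGraph] at h0
  have h1 := left_ne_zero_of_mul h0
  set P : (V → Bool) → ℂ := fun x => ∏ v, (if f (Sum.inl v) then yGate else hadamard)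
    (z (Sum.inl v)) (x v) with hP
  set W : (V → Bool) → ℂ := fun x => ∏ e : G.edgeSet,
    ∑ b : Bool, (if f (Sum.inr e) then yGate else hadamard) (z (Sum.inr e)) b *
      (if b then ∏ v : V, if v ∈ e.1 then boolSign (x v) else 1 else 1) with hW
  -- Each edge has two endpoints, so the two sign changes cancel.
  have hWnot : ∀ x : V → Bool, W (fun v => !x v) = W x := by
    intro x
    refine Finset.prod_congr rfl fun e _ => Finset.sum_congr rfl fun b _ => ?_
    obtain ⟨v, w, hvw⟩ : ∃ v w, e.1 = s(v, w) := by
      induction h : e.1 using Sym2.ind with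
      | _ v w => exact ⟨v, w, rfl⟩
    rw [prod_mem_edge G e hvw, prod_mem_edge G e hvw, boolSign_not, boolSign_not, neg_mul_neg]
  -- If every complementary pair cancelled, twice the nonzero sum would vanish. No connectedness of
  -- `G` is needed.
  obtain ⟨y, hy⟩ : ∃ y, P y * W y + P (fun v => !y v) * W (fun v => !y v) ≠ 0 := by
    by_contra! hcon
    apply h1
    have h2 : ∑ x, P x * W x = ∑ x : V → Bool, P (fun v => !x v) * W (fun v => !x v) :=
      (Equiv.sum_comp (Equiv.arrowCongr (Equiv.refl V) Equiv.boolNot)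
        (fun x => P x * W x)).symm
    have h3 : ∑ x, P x * W x + ∑ x, P x * W x = 0 := by
      nth_rewrite 2 [h2]
      rw [← Finset.sum_add_distrib]
      exact Finset.sum_eq_zero fun x _ => hcon x
    exact add_self_eq_zero.mp h3
  rw [hWnot, ← add_mul] at hy
  have hWy := right_ne_zero_of_mul hy
  have hPy := left_ne_zero_of_mul hy
  refine ⟨y, fun e v w hvw => ?_, fun t ht => ?_⟩
  -- The factor of `e` in `W y` is proportional to $1+(-1)^{z_e+y_v+y_w}$.
  · have he := Finset.prod_ne_zero_iff.mp hWy e (Finset.mem_univ e)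
    rw [Fintype.sum_bool, prod_mem_edge G e hvw, hf] at he
    revert he
    cases z (Sum.inr e) <;> cases y v <;> cases y w <;> simp [hadamard, boolSign]
  · by_contra hodd
    apply hPy
    -- Here $(-i)^{2t}=(-1)^t$, so an odd exponent would make the complementary terms cancel.
    have hPn : P (fun v => !y v) = P y * ((-1) ^ (∑ v, (z (Sum.inl v)).toNat +
          ∑ v, (if f (Sum.inl v) then (y v).toNat else 0)) * (-Complex.I) ^ (2 * t)) := by
      simp only [hP, measureOp_not, Finset.prod_mul_distrib]
      rw [Finset.prod_pow_eq_pow_sum, Finset.prod_pow_eq_pow_sum, ← Finset.sum_add_distrib, ← ht]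
      congr 3
      refine Finset.sum_congr rfl fun v _ => ?_
      cases f (Sum.inl v) <;> rfl
    rw [hPn, pow_mul, neg_sq, Complex.I_sq, ← pow_add, (Nat.not_even_iff_odd.mp hodd).neg_one_pow]
    ring

end GraphStates

/-! ## Locality of classical circuits -/

section Locality

variable {ι o : Type}

/-- A gate of depth `t` in a circuit of fanin at most `K` depends on at most `K ^ t` inputs. -/
theorem BoolCircuit.exists_gate_cone [DecidableEq ι] (C : BoolCircuit ι o) {K : ℕ}
    (hC : C.FaninLE K) (g : Fin C.size) :
    ∃ S : Finset ι, S.card ≤ K ^ C.gateDepth g ∧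
      ∀ x y : ι → Bool, (∀ i ∈ S, x i = y i) → C.gateVal x g = C.gateVal y g := by
  induction g using WellFoundedLT.induction with
  | ind g ih =>
    set D : ℕ := Finset.univ.sup fun j => match C.src g j with
      | Sum.inl _ => 0
      | Sum.inr h => C.gateDepth h.1 with hD
    have hdepth : C.gateDepth g = 1 + D := BoolCircuit.gateDepth.eq_def C g
    -- A gate without wires is constant; any other gate gives `1 ≤ K`, which makes powers of `K`
    -- monotone in the depth.
    rcases Nat.eq_zero_or_pos (C.fanin g) with h0 | hpos
    · refine ⟨∅, by simp, fun x y _ => ?_⟩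
      rw [BoolCircuit.gateVal, BoolCircuit.gateVal]
      congr 1
      funext j
      exact absurd j.2 (by omega)
    have hK : 1 ≤ K := le_trans hpos (hC g)
    have hwire : ∀ j : Fin (C.fanin g), ∃ S : Finset ι, S.card ≤ K ^ D ∧
        ∀ x y : ι → Bool, (∀ i ∈ S, x i = y i) →
          (match C.src g j with
            | Sum.inl i => x i
            | Sum.inr h => C.gateVal x h.1) =
          (match C.src g j with
            | Sum.inl i => y i
            | Sum.inr h => C.gateVal y h.1) := by
      intro j
      have hle := Finset.le_sup (f := fun j => match C.src g j with
        | Sum.inl _ => 0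
        | Sum.inr h => C.gateDepth h.1) (Finset.mem_univ j)
      rw [← hD] at hle
      rcases hs : C.src g j with i | h
      · exact ⟨{i}, by simpa using Nat.one_le_pow _ _ hK, fun x y hxy => hxy i (by simp)⟩
      · simp only [hs] at hle
        obtain ⟨S, hS, hS'⟩ := ih h.1 h.2
        exact ⟨S, hS.trans (Nat.pow_le_pow_right hK hle), hS'⟩
    choose S hS hS' using hwire
    refine ⟨Finset.univ.biUnion S, ?_, fun x y hxy => ?_⟩
    · calc (Finset.univ.biUnion S).card ≤ (Finset.univ : Finset (Fin (C.fanin g))).card * K ^ D :=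
            Finset.card_biUnion_le_card_mul _ _ _ fun j _ => hS j
        _ ≤ K * K ^ D := by
            rw [Finset.card_univ, Fintype.card_fin]
            exact Nat.mul_le_mul_right _ (hC g)
        _ = K ^ C.gateDepth g := by rw [hdepth, pow_add, pow_one]
    · rw [BoolCircuit.gateVal, BoolCircuit.gateVal]
      congr 1
      funext j
      exact hS' j x y fun i hi => hxy i (Finset.mem_biUnion.mpr ⟨j, Finset.mem_univ j, hi⟩)

/-- An output of a circuit of fanin at most `K` depends on at most `K ^ depth` inputs. -/
theorem BoolCircuit.exists_cone [DecidableEq ι] [Fintype o] (C : BoolCircuit ι o) {K : ℕ}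
    (hK : 1 ≤ K) (hC : C.FaninLE K) (a : o) :
    ∃ S : Finset ι, S.card ≤ K ^ C.depth ∧
      ∀ x y : ι → Bool, (∀ i ∈ S, x i = y i) → C.eval x a = C.eval y a := by
  have hle := Finset.le_sup (f := fun a => match C.out a with
    | Sum.inl _ => 0
    | Sum.inr g => C.gateDepth g) (Finset.mem_univ a)
  change _ ≤ C.depth at hle
  simp only [BoolCircuit.eval]
  rcases hs : C.out a with i | g
  · exact ⟨{i}, by simpa using Nat.one_le_pow _ _ hK, fun x y hxy => hxy i (by simp)⟩
  · simp only [hs] at hle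
    obtain ⟨S, hS, hS'⟩ := C.exists_gate_cone hC g
    exact ⟨S, hS.trans (Nat.pow_le_pow_right hK hle), hS'⟩

/-- Locality of a randomized circuit whose random string is fixed. -/
theorem RandCircuit.exists_cones [DecidableEq ι] [Fintype o] (C : RandCircuit ι o) {K : ℕ}
    (hK : 1 ≤ K) (hC : C.circuit.FaninLE K) (r : Fin C.rand → Bool) :
    ∃ S : o → Finset ι, ∀ a, (S a).card ≤ K ^ C.circuit.depth ∧
      ∀ x y : ι → Bool, (∀ i ∈ S a, x i = y i) →
        C.circuit.eval (Sum.elim x r) a = C.circuit.eval (Sum.elim y r) a := by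
  choose S hS hS' using C.circuit.exists_cone hK hC
  refine ⟨fun a => (S a).toLeft, fun a => ⟨Finset.card_toLeft_le.trans (hS a), ?_⟩⟩
  intro x y hxy
  refine hS' a _ _ ?_
  rintro (i | j) hi
  · exact hxy i (Finset.mem_toLeft.mpr hi)
  · rfl

end Locality

/-! ## Functions of three bits -/

section Parity

/-- A bit as an element of `ZMod 2`. -/
def bitVal (b : Bool) : ZMod 2 := if b then 1 else 0

theorem bitVal_xor (a b : Bool) : bitVal (xor a b) = bitVal a + bitVal b := by
  revert a b; decide

theorem bitVal_eq_toNat (b : Bool) : bitVal b = (b.toNat : ZMod 2) := by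
  cases b <;> rfl

theorem zmod_two_add_self (x : ZMod 2) : x + x = 0 := CharTwo.add_self_eq_zero x

/-- The sums of a function of three bits over the points of even weight and over the points of odd
weight vanish. -/
def ParitySumsVanish (g : Bool → Bool → Bool → ZMod 2) : Prop :=
  g false false false + g true true false + g true false true + g false true true = 0 ∧
  g true false false + g false true false + g false false true + g true true true = 0

theorem ParitySumsVanish.zero : ParitySumsVanish fun _ _ _ => 0 := by
  simp [ParitySumsVanish]

theorem ParitySumsVanish.add {g h : Bool → Bool → Bool → ZMod 2} (hg : ParitySumsVanish g)
    (hh : ParitySumsVanish h) : ParitySumsVanish fun α β γ => g α β γ + h α β γ :=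
  ⟨by linear_combination hg.1 + hh.1, by linear_combination hg.2 + hh.2⟩

theorem ParitySumsVanish.sum {κ : Type} (s : Finset κ) {g : κ → Bool → Bool → Bool → ZMod 2}
    (hg : ∀ i ∈ s, ParitySumsVanish (g i)) :
    ParitySumsVanish fun α β γ => ∑ i ∈ s, g i α β γ := by
  classical
  induction s using Finset.induction_on with
  | empty => simpa using ParitySumsVanish.zero
  | insert i s hi ih =>
    simp only [Finset.sum_insert hi]
    exact (hg i (Finset.mem_insert_self i s)).add
      (ih fun j hj => hg j (Finset.mem_insert_of_mem hj))

theorem ParitySumsVanish.const_mul (k : ZMod 2) {g : Bool → Bool → Bool → ZMod 2}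
    (hg : ParitySumsVanish g) : ParitySumsVanish fun α β γ => k * g α β γ :=
  ⟨by linear_combination k * hg.1, by linear_combination k * hg.2⟩

/-- Among the four points of either parity, each value of a given bit occurs exactly twice. -/
theorem ParitySumsVanish.of_first (h : Bool → ZMod 2) : ParitySumsVanish fun α _ _ => h α :=
  ⟨by linear_combination zmod_two_add_self (h true) + zmod_two_add_self (h false),
    by linear_combination zmod_two_add_self (h true) + zmod_two_add_self (h false)⟩

theorem ParitySumsVanish.of_second (h : Bool → ZMod 2) : ParitySumsVanish fun _ β _ => h β :=
  ⟨by linear_combination zmod_two_add_self (h true) + zmod_two_add_self (h false),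
    by linear_combination zmod_two_add_self (h true) + zmod_two_add_self (h false)⟩

theorem ParitySumsVanish.of_third (h : Bool → ZMod 2) : ParitySumsVanish fun _ _ γ => h γ :=
  ⟨by linear_combination zmod_two_add_self (h true) + zmod_two_add_self (h false),
    by linear_combination zmod_two_add_self (h true) + zmod_two_add_self (h false)⟩

/-- Two functions, one independent of the third bit, the other of the second, whose sum is
independent of the first, cannot satisfy this system of parity constraints. -/
theorem parity_system_unsolvable {S B C : Bool → Bool → Bool → ZMod 2} (hS : ParitySumsVanish S)
    (hB : ∀ α β γ, B α β γ = B α β true) (hC : ∀ α β γ, C α β γ = C α true γ)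
    (hBC : ∀ α β γ, B α β γ + C α β γ = B true β γ + C true β γ) (N : ℕ)
    (h : ∀ α β γ t, N + (α.toNat + β.toNat + γ.toNat) = 2 * t →
      S α β γ + bitVal β * B α β γ + bitVal γ * C α β γ = t) : False := by
  have key := hBC false true true
  rcases Nat.even_or_odd' N with ⟨n, hn | hn⟩
  · have e1 := h false false false n (by simp [hn])
    have e2 := h true true false (n + 1) (by simp [hn]; ring)
    have e3 := h true false true (n + 1) (by simp [hn]; ring)
    have e4 := h false true true (n + 1) (by simp [hn]; ring)
    rw [hB true true false] at e2
    rw [hC true false true] at e3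
    simp only [bitVal, if_true, Bool.false_eq_true, if_false] at e1 e2 e3 e4
    push_cast at e1 e2 e3 e4
    have : (1 : ZMod 2) = 0 := by
      linear_combination hS.1 - e1 - e2 - e3 - e4 + key + (B true true true + C true true true +
        (-2) * (n : ZMod 2) - 1) * zmod_two_add_self 1
    exact one_ne_zero this
  · have e1 := h true false false (n + 1) (by simp [hn]; ring)
    have e2 := h false true false (n + 1) (by simp [hn]; ring)
    have e3 := h false false true (n + 1) (by simp [hn]; ring)
    have e4 := h true true true (n + 2) (by simp [hn]; ring)
    rw [hB false true false] at e2
    rw [hC false false true] at e3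
    simp only [bitVal, if_true, Bool.false_eq_true, if_false] at e1 e2 e3 e4
    push_cast at e1 e2 e3 e4
    have : (1 : ZMod 2) = 0 := by
      linear_combination hS.2 - e1 - e2 - e3 - e4 + key + (B true true true + C true true true +
        (-2) * (n : ZMod 2) - 2) * zmod_two_add_self 1
    exact one_ne_zero this

end Parity

/-! ## The nonlocal parity obstruction -/

section Obstruction

variable {P U : Type} [Fintype P] [Fintype U] [DecidableEq U]

/-- Reachability along edges whose middle outcomes do not depend on the input `c`. -/
def ReachAvoiding (G : SimpleGraph (P ⊕ U)) (S : (P ⊕ U) ⊕ G.edgeSet → Finset U) (c : U) :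
    P ⊕ U → P ⊕ U → Prop :=
  Relation.ReflTransGen fun v w => ∃ h : G.Adj v w, c ∉ S (Sum.inr ⟨s(v, w), h⟩)

/-- If every output depends on at most one of three inputs, and any two of the three corresponding
vertices are joined by a path whose outputs do not depend on the third input, then for some values
of the three inputs the output violates the parity conditions of the graph state. -/
theorem exists_parity_violation (G : SimpleGraph (P ⊕ U))
    (F : (U → Bool) → (P ⊕ U) ⊕ G.edgeSet → Bool)
    (S : (P ⊕ U) ⊕ G.edgeSet → Finset U)
    (hS : ∀ o x y, (∀ i ∈ S o, x i = y i) → F x o = F y o) {a b c : U}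
    (hab : a ≠ b) (hac : a ≠ c) (hbc : b ≠ c)
    (sab : ∀ o, a ∈ S o → b ∉ S o) (sac : ∀ o, a ∈ S o → c ∉ S o) (sbc : ∀ o, b ∈ S o → c ∉ S o)
    (hconn : ∀ u : U, Relation.ReflTransGen G.Adj (Sum.inr a) (Sum.inr u))
    (rab : ReachAvoiding G S c (Sum.inr a) (Sum.inr b))
    (rac : ReachAvoiding G S b (Sum.inr a) (Sum.inr c))
    (rbc : ReachAvoiding G S a (Sum.inr b) (Sum.inr c)) (A : U → Bool) :
    ∃ α β γ, ∀ A', A' = Function.update (Function.update (Function.update A a α) b β) c γ →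
      ¬ ∃ y : P ⊕ U → Bool,
        (∀ (e : G.edgeSet) v w, e.1 = s(v, w) → F A' (Sum.inr e) = xor (y v) (y w)) ∧
        ∀ t : ℕ, ∑ u, (A' u).toNat = 2 * t →
          Even (∑ v, (F A' (Sum.inl v)).toNat +
            ∑ u, (if A' u then (y (Sum.inr u)).toNat else 0) + t) := by
  by_contra! hcon
  set M : Bool → Bool → Bool → U → Bool := fun α β γ =>
    Function.update (Function.update (Function.update A a α) b β) c γ with hM
  have hMa : ∀ α β γ, M α β γ a = α := fun α β γ => by
    simp [hM, hab, hac]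
  have hMb : ∀ α β γ, M α β γ b = β := fun α β γ => by
    simp [hM, hbc]
  have hMc : ∀ α β γ, M α β γ c = γ := fun α β γ => by
    simp [hM]
  have hMo : ∀ α β γ u, u ≠ a → u ≠ b → u ≠ c → M α β γ u = A u := fun α β γ u h1 h2 h3 => by
    simp [hM, h1, h2, h3]
  have hall : ∀ α β γ, ∃ y : P ⊕ U → Bool,
        (∀ (e : G.edgeSet) v w, e.1 = s(v, w) → F (M α β γ) (Sum.inr e) = xor (y v) (y w)) ∧
        ∀ t : ℕ, ∑ u, (M α β γ u).toNat = 2 * t →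
          Even (∑ v, (F (M α β γ) (Sum.inl v)).toNat +
            ∑ u, (if M α β γ u then (y (Sum.inr u)).toNat else 0) + t) := by
    intro α β γ
    obtain ⟨A', rfl, h⟩ := hcon α β γ
    exact h
  choose y hy hpar using hall
  have locA : ∀ o, a ∉ S o → ∀ α α' β γ, F (M α β γ) o = F (M α' β γ) o := by
    intro o ho α α' β γ
    refine hS o _ _ fun i hi => ?_
    have hia : i ≠ a := fun h => ho (h ▸ hi)
    by_cases hib : i = b
    · rw [hib, hMb, hMb]
    by_cases hic : i = c
    · rw [hic, hMc, hMc]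
    rw [hMo _ _ _ _ hia hib hic, hMo _ _ _ _ hia hib hic]
  have locB : ∀ o, b ∉ S o → ∀ α β β' γ, F (M α β γ) o = F (M α β' γ) o := by
    intro o ho α β β' γ
    refine hS o _ _ fun i hi => ?_
    have hib : i ≠ b := fun h => ho (h ▸ hi)
    by_cases hia : i = a
    · rw [hia, hMa, hMa]
    by_cases hic : i = c
    · rw [hic, hMc, hMc]
    rw [hMo _ _ _ _ hia hib hic, hMo _ _ _ _ hia hib hic]
  have locC : ∀ o, c ∉ S o → ∀ α β γ γ', F (M α β γ) o = F (M α β γ') o := by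
    intro o ho α β γ γ'
    refine hS o _ _ fun i hi => ?_
    have hic : i ≠ c := fun h => ho (h ▸ hi)
    by_cases hia : i = a
    · rw [hia, hMa, hMa]
    by_cases hib : i = b
    · rw [hib, hMb, hMb]
    rw [hMo _ _ _ _ hia hib hic, hMo _ _ _ _ hia hib hic]
  -- Every output sees at most one of the three bits.
  have hout : ∀ o, ParitySumsVanish fun α β γ => bitVal (F (M α β γ) o) := by
    intro o
    by_cases ha : a ∈ S o
    · have h : (fun α β γ => bitVal (F (M α β γ) o)) =
          fun α _ _ => bitVal (F (M α true true) o) := by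
        funext α β γ
        rw [locB o (sab o ha) α β true γ, locC o (sac o ha) α true γ true]
      rw [h]; exact .of_first _
    by_cases hb : b ∈ S o
    · have h : (fun α β γ => bitVal (F (M α β γ) o)) =
          fun _ β _ => bitVal (F (M true β true) o) := by
        funext α β γ
        rw [locA o ha α true β γ, locC o (sbc o hb) true β γ true]
      rw [h]; exact .of_second _
    · have h : (fun α β γ => bitVal (F (M α β γ) o)) =
          fun _ _ γ => bitVal (F (M true true γ) o) := by
        funext α β γ
        rw [locA o ha α true β γ, locB o hb true β true γ]
      rw [h]; exact .of_third _
  -- The potentials `y` are chosen separately for each setting and need not be local; their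
  -- differences are sums of edge outputs along any path, and so inherit the locality of that path.
  set Y : Bool → Bool → Bool → P ⊕ U → P ⊕ U → ZMod 2 := fun α β γ v w =>
    bitVal (y α β γ v) + bitVal (y α β γ w) with hY
  have hstep : ∀ α β γ r v w, ∀ h : G.Adj v w,
      Y α β γ r w = Y α β γ r v + bitVal (F (M α β γ) (Sum.inr ⟨s(v, w), h⟩)) := by
    intro α β γ r v w h
    rw [hy α β γ ⟨s(v, w), h⟩ v w rfl, bitVal_xor]
    simp only [hY]
    linear_combination -zmod_two_add_self (bitVal (y α β γ v))
  have hYself : ∀ α β γ r, Y α β γ r r = 0 := fun α β γ r => zmod_two_add_self _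
  have hYvanish : ∀ u : U, ParitySumsVanish fun α β γ => Y α β γ (Sum.inr a) (Sum.inr u) := by
    intro u
    have hu := hconn u
    generalize (Sum.inr u : P ⊕ U) = w at hu ⊢
    induction hu with
    | refl => simpa only [hYself] using ParitySumsVanish.zero
    | tail _ h ih =>
      simp only [hstep _ _ _ _ _ _ h]
      exact ih.add (hout _)
  have hYB : ∀ α β γ γ', Y α β γ (Sum.inr a) (Sum.inr b) = Y α β γ' (Sum.inr a) (Sum.inr b) := by
    intro α β γ γ'
    unfold ReachAvoiding at rab
    generalize (Sum.inr b : P ⊕ U) = w at rab ⊢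
    induction rab with
    | refl => rw [hYself, hYself]
    | tail _ h ih =>
      obtain ⟨h, hc⟩ := h
      rw [hstep _ _ _ _ _ _ h, hstep _ _ _ _ _ _ h, ih, locC _ hc α β γ γ']
  have hYC : ∀ α β β' γ, Y α β γ (Sum.inr a) (Sum.inr c) = Y α β' γ (Sum.inr a) (Sum.inr c) := by
    intro α β β' γ
    unfold ReachAvoiding at rac
    generalize (Sum.inr c : P ⊕ U) = w at rac ⊢
    induction rac with
    | refl => rw [hYself, hYself]
    | tail _ h ih =>
      obtain ⟨h, hc⟩ := h
      rw [hstep _ _ _ _ _ _ h, hstep _ _ _ _ _ _ h, ih, locB _ hc α β β' γ]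
  have hYBC : ∀ α α' β γ, Y α β γ (Sum.inr b) (Sum.inr c) = Y α' β γ (Sum.inr b) (Sum.inr c) := by
    intro α α' β γ
    unfold ReachAvoiding at rbc
    generalize (Sum.inr c : P ⊕ U) = w at rbc ⊢
    induction rbc with
    | refl => rw [hYself, hYself]
    | tail _ h ih =>
      obtain ⟨h, hc⟩ := h
      rw [hstep _ _ _ _ _ _ h, hstep _ _ _ _ _ _ h, ih, locA _ hc α α' β γ]
  have hYsum : ∀ α β γ, Y α β γ (Sum.inr a) (Sum.inr b) + Y α β γ (Sum.inr a) (Sum.inr c) =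
      Y α β γ (Sum.inr b) (Sum.inr c) := by
    intro α β γ
    simp only [hY]
    linear_combination zmod_two_add_self (bitVal (y α β γ (Sum.inr a)))
  set R : Finset U := ((Finset.univ.erase a).erase b).erase c with hR
  have hRmem : ∀ u ∈ R, u ≠ a ∧ u ≠ b ∧ u ≠ c := by
    intro u hu
    simp only [hR, Finset.mem_erase] at hu
    exact ⟨hu.2.2.1, hu.2.1, hu.1⟩
  have hsplit : ∀ {T : Type} [AddCommMonoid T] (g : U → T),
      ∑ u, g u = g a + (g b + (g c + ∑ u ∈ R, g u)) := by
    intro T _ g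
    rw [hR, Finset.add_sum_erase _ g (by simp [hac.symm, hbc.symm]),
      Finset.add_sum_erase _ g (by simp [hab.symm]), Finset.add_sum_erase _ g (by simp)]
  refine parity_system_unsolvable
    (S := fun α β γ => ∑ v, bitVal (F (M α β γ) (Sum.inl v)) +
      ∑ u ∈ R, bitVal (A u) * Y α β γ (Sum.inr a) (Sum.inr u))
    (B := fun α β γ => Y α β γ (Sum.inr a) (Sum.inr b))
    (C := fun α β γ => Y α β γ (Sum.inr a) (Sum.inr c))
    ((ParitySumsVanish.sum _ fun v _ => hout _).add
      (ParitySumsVanish.sum _ fun u _ => (hYvanish u).const_mul _))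
    (fun α β γ => hYB α β γ true) (fun α β γ => hYC α β true γ)
    (fun α β γ => by rw [hYsum, hYsum]; exact hYBC α true β γ)
    (∑ u ∈ R, (A u).toNat) ?_
  intro α β γ t ht
  have hsum : ∑ u, (M α β γ u).toNat = 2 * t := by
    rw [hsplit, hMa, hMb, hMc, ← ht, Finset.sum_congr rfl fun u hu => by
      rw [hMo _ _ _ u (hRmem u hu).1 (hRmem u hu).2.1 (hRmem u hu).2.2]]
    ring
  have heven := (ZMod.natCast_eq_zero_iff_even).mpr (hpar α β γ t hsum)
  -- Even weight allows $y_a$ to be added to every $y_u$ without changing $\sum_u A_u y_u$.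
  have hsum2 : ∑ u, bitVal (M α β γ u) = 0 := by
    simp only [bitVal_eq_toNat]
    rw [← Nat.cast_sum, hsum, ZMod.natCast_eq_zero_iff_even]
    exact even_two_mul t
  have hlin : ∑ u, bitVal (M α β γ u) * bitVal (y α β γ (Sum.inr u)) =
      ∑ u, bitVal (M α β γ u) * Y α β γ (Sum.inr a) (Sum.inr u) := by
    simp only [hY, mul_add, Finset.sum_add_distrib, ← Finset.sum_mul, hsum2, zero_mul, zero_add]
  have hterm : ∀ u, (if M α β γ u then bitVal (y α β γ (Sum.inr u)) else 0) =
      bitVal (M α β γ u) * bitVal (y α β γ (Sum.inr u)) := by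
    intro u
    cases M α β γ u <;> simp [bitVal]
  push_cast at heven
  simp only [← bitVal_eq_toNat, hterm, hlin] at heven
  have hcongr : ∑ u ∈ R, bitVal (M α β γ u) * Y α β γ (Sum.inr a) (Sum.inr u) =
      ∑ u ∈ R, bitVal (A u) * Y α β γ (Sum.inr a) (Sum.inr u) :=
    Finset.sum_congr rfl fun u hu => by
      rw [hMo _ _ _ u (hRmem u hu).1 (hRmem u hu).2.1 (hRmem u hu).2.2]
  rw [hsplit (fun u => bitVal (M α β γ u) * Y α β γ (Sum.inr a) (Sum.inr u)), hMa, hMb, hMc,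
    hYself, hcongr] at heven
  linear_combination heven - zmod_two_add_self (t : ZMod 2)

end Obstruction

/-! ## Geometry of the grid graph -/

section Grid

/-- There are no control indices when `d ≤ 1`. -/
theorem ctrl_pred_pos {d : ℕ} (i : Fin (ctrlSide d)) : 0 < d - 1 := by
  rcases Nat.eq_zero_or_pos (d - 1) with h | h
  · have := i.2
    simp [ctrlSide, h] at this
  · exact h

/-- The box number is below $d^2$ and the offset inside the box is at most $d-2$, so the upper
corner stays in the same box. -/
theorem cellCoord_add_one_lt {d : ℕ} (i : Fin (ctrlSide d)) : cellCoord d i + 1 < d ^ 3 := by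
  have hd := ctrl_pred_pos i
  obtain ⟨e, rfl⟩ : ∃ e, d = e + 2 := ⟨d - 2, by omega⟩
  have hi : (i : ℕ) < (e + 2) ^ 2 * (e + 1) := i.2
  have h1 : (i : ℕ) / (e + 1) < (e + 2) ^ 2 := (Nat.div_lt_iff_lt_mul (by omega)).mpr hi
  have h2 : (i : ℕ) % (e + 1) < e + 1 := Nat.mod_lt _ (by omega)
  change (e + 2) * ((i : ℕ) / (e + 1)) + (i : ℕ) % (e + 1) + 1 < _
  calc (e + 2) * ((i : ℕ) / (e + 1)) + (i : ℕ) % (e + 1) + 1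
      < (e + 2) * ((i : ℕ) / (e + 1)) + (e + 2) := by omega
    _ = (e + 2) * ((i : ℕ) / (e + 1) + 1) := by ring
    _ ≤ (e + 2) * (e + 2) ^ 2 := Nat.mul_le_mul_left _ h1
    _ = (e + 2) ^ 3 := by ring

/-- The offset is smaller than $d$, so division by $d$ recovers both box number and offset. -/
theorem cellCoord_injective {d : ℕ} {i j : Fin (ctrlSide d)}
    (h : cellCoord d i = cellCoord d j) : i = j := by
  have hd := ctrl_pred_pos i
  obtain ⟨e, rfl⟩ : ∃ e, d = e + 2 := ⟨d - 2, by omega⟩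
  have h2 : (i : ℕ) % (e + 1) < e + 2 := (Nat.mod_lt _ (by omega)).trans (by omega)
  have h3 : (j : ℕ) % (e + 1) < e + 2 := (Nat.mod_lt _ (by omega)).trans (by omega)
  change (e + 2) * ((i : ℕ) / (e + 1)) + (i : ℕ) % (e + 1) =
    (e + 2) * ((j : ℕ) / (e + 1)) + (j : ℕ) % (e + 1) at h
  have hmod := congrArg (· % (e + 2)) h
  have hdiv := congrArg (· / (e + 2)) h
  simp only [Nat.mul_add_mod, Nat.mod_eq_of_lt h2, Nat.mod_eq_of_lt h3] at hmod
  simp only [Nat.mul_add_div (show 0 < e + 2 by omega), Nat.div_eq_of_lt h2,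
    Nat.div_eq_of_lt h3, add_zero] at hdiv
  apply Fin.ext
  rw [← Nat.div_add_mod (i : ℕ) (e + 1), ← Nat.div_add_mod (j : ℕ) (e + 1), hmod, hdiv]

/-- Position of a vertex in the plane, in units of half a grid step. -/
def vertexPos (d : ℕ) : GridVertex d → ℤ × ℤ
  | Sum.inl p => (2 * (p.1 : ℕ), 2 * (p.2 : ℕ))
  | Sum.inr u => (2 * (cellCoord d u.1 : ℕ) + 1, 2 * (cellCoord d u.2 : ℕ) + 1)

/-- Grid points have even coordinates and control vertices odd ones, so the two kinds cannot
collide. -/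
theorem vertexPos_injective (d : ℕ) : Function.Injective (vertexPos d) := by
  rintro (⟨p1, p2⟩ | ⟨u1, u2⟩) (⟨q1, q2⟩ | ⟨w1, w2⟩) h
  all_goals simp only [vertexPos, Prod.mk.injEq] at h
  · have h1 : p1 = q1 := Fin.ext (by omega)
    have h2 : p2 = q2 := Fin.ext (by omega)
    rw [h1, h2]
  · omega
  · omega
  · have h1 : u1 = w1 := cellCoord_injective (by omega)
    have h2 : u2 = w2 := cellCoord_injective (by omega)
    rw [h1, h2]

/-- The displacements between adjacent vertices. -/
noncomputable def displacements : Finset (ℤ × ℤ) := Finset.Icc (-2) 2 ×ˢ Finset.Icc (-2) 2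

theorem card_displacements : displacements.card = 25 := by
  simp [displacements]

theorem vertexPos_sub_mem_displacements {d : ℕ} {v w : GridVertex d} (h : (gridGraph d).Adj v w) :
    vertexPos d w - vertexPos d v ∈ displacements := by
  rcases v with ⟨p1, p2⟩ | ⟨u1, u2⟩ <;> rcases w with ⟨q1, q2⟩ | ⟨w1, w2⟩
  · change Nat.dist p1 q1 + Nat.dist p2 q2 = 1 at h
    simp only [Nat.dist] at h
    simp only [displacements, vertexPos, Finset.mem_product, Finset.mem_Icc, Prod.fst_sub,
      Prod.snd_sub]
    omega
  · change ((p1 : ℕ) = cellCoord d w1 ∨ (p1 : ℕ) = cellCoord d w1 + 1) ∧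
      ((p2 : ℕ) = cellCoord d w2 ∨ (p2 : ℕ) = cellCoord d w2 + 1) at h
    simp only [displacements, vertexPos, Finset.mem_product, Finset.mem_Icc, Prod.fst_sub,
      Prod.snd_sub]
    omega
  · change ((q1 : ℕ) = cellCoord d u1 ∨ (q1 : ℕ) = cellCoord d u1 + 1) ∧
      ((q2 : ℕ) = cellCoord d u2 ∨ (q2 : ℕ) = cellCoord d u2 + 1) at h
    simp only [displacements, vertexPos, Finset.mem_product, Finset.mem_Icc, Prod.fst_sub,
      Prod.snd_sub]
    omega
  · exact h.elim

theorem card_outIdx_le {d : ℕ} (hd : 2 ≤ d) : Fintype.card (OutIdx d) ≤ 130 * ctrlSide d ^ 2 := by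
  -- A neighbour is determined by its displacement.
  have hdeg : ∀ v, (gridGraph d).degree v ≤ 25 := by
    intro v
    rw [← card_displacements, ← SimpleGraph.card_neighborFinset_eq_degree]
    refine Finset.card_le_card_of_injOn (fun w => vertexPos d w - vertexPos d v) ?_ ?_
    · intro w hw
      exact vertexPos_sub_mem_displacements ((SimpleGraph.mem_neighborFinset _ _ _).mp hw)
    · intro w _ w' _ h
      exact vertexPos_injective d (sub_left_injective h)
  -- From $d^3\le 2k$ there are at most $4k^2$ grid points, besides the $k^2$ control vertices.
  have hV : Fintype.card (GridVertex d) ≤ 5 * ctrlSide d ^ 2 := by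
    have h3 : d ^ 3 ≤ 2 * ctrlSide d := by
      obtain ⟨e, rfl⟩ : ∃ e, d = e + 2 := ⟨d - 2, by omega⟩
      change _ ≤ 2 * ((e + 2) ^ 2 * (e + 1))
      nlinarith [sq_nonneg (e + 2)]
    simp only [GridVertex, Fintype.card_sum, Fintype.card_prod, Fintype.card_fin]
    have h6 := Nat.mul_le_mul h3 h3
    nlinarith
  have hE : 2 * Fintype.card (gridGraph d).edgeSet ≤ Fintype.card (GridVertex d) * 25 := by
    rw [← SimpleGraph.edgeFinset_card, ← SimpleGraph.sum_degrees_eq_twice_card_edges,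
      ← Finset.card_univ]
    exact Finset.sum_le_card_nsmul _ _ _ fun v _ => hdeg v
  change Fintype.card (GridVertex d ⊕ (gridGraph d).edgeSet) ≤ _
  rw [Fintype.card_sum]
  omega

/-- Edges that meet the grid row or the grid column through the lower corner of the unit square
of a control vertex. -/
def MeetsCross {d : ℕ} (a : InIdx d) (e : Sym2 (GridVertex d)) : Prop :=
  ∃ p : Fin (d ^ 3) × Fin (d ^ 3), Sum.inl p ∈ e ∧
    ((p.1 : ℕ) = cellCoord d a.1 ∨ (p.2 : ℕ) = cellCoord d a.2)

theorem exists_grid_segment {d : ℕ} {T : GridVertex d → GridVertex d → Prop}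
    (f : Fin (d ^ 3) → Fin (d ^ 3) × Fin (d ^ 3))
    (hf : ∀ x y : Fin (d ^ 3), Nat.dist x y = 1 → T (Sum.inl (f x)) (Sum.inl (f y)))
    (x y : Fin (d ^ 3)) : Relation.ReflTransGen T (Sum.inl (f x)) (Sum.inl (f y)) := by
  have hup : ∀ n : ℕ, ∀ (x y : Fin (d ^ 3)), (y : ℕ) = x + n →
      Relation.ReflTransGen T (Sum.inl (f x)) (Sum.inl (f y)) ∧
      Relation.ReflTransGen T (Sum.inl (f y)) (Sum.inl (f x)) := by
    intro n
    induction n with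
    | zero =>
      intro x y h
      have : y = x := Fin.ext (by omega)
      subst this
      exact ⟨.refl, .refl⟩
    | succ n ih =>
      intro x y h
      have hy := y.2
      obtain ⟨h1, h2⟩ := ih x ⟨x + n, by omega⟩ rfl
      exact ⟨h1.tail (hf _ _ (by simp only [Nat.dist]; omega)),
        h2.head (hf _ _ (by simp only [Nat.dist]; omega))⟩
  rcases le_total (x : ℕ) y with h | h
  · exact (hup (y - x) x y (by omega)).1
  · exact (hup (x - y) y x (by omega)).2

/-- Any two control vertices are joined by a path inside their crosses. -/
theorem exists_path_in_crosses {d : ℕ} (a b : InIdx d) :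
    Relation.ReflTransGen (fun v w => (gridGraph d).Adj v w ∧
      (MeetsCross a s(v, w) ∨ MeetsCross b s(v, w))) (Sum.inr a) (Sum.inr b) := by
  set ax : Fin (d ^ 3) := ⟨cellCoord d a.1, (Nat.lt_succ_self _).trans (cellCoord_add_one_lt a.1)⟩
  set ay : Fin (d ^ 3) := ⟨cellCoord d a.2, (Nat.lt_succ_self _).trans (cellCoord_add_one_lt a.2)⟩
  set bx : Fin (d ^ 3) := ⟨cellCoord d b.1, (Nat.lt_succ_self _).trans (cellCoord_add_one_lt b.1)⟩
  set bdy : Fin (d ^ 3) := ⟨cellCoord d b.2, (Nat.lt_succ_self _).trans (cellCoord_add_one_lt b.2)⟩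
  -- The path enters the lower corner of `a`, follows the column of `a` to the row of `b`, and then
  -- that row to the lower corner of `b`.
  refine Relation.ReflTransGen.head (b := Sum.inl (ax, ay))
    ⟨⟨Or.inl rfl, Or.inl rfl⟩, Or.inl ⟨(ax, ay), Sym2.mem_mk_right _ _, Or.inl rfl⟩⟩ ?_
  refine Relation.ReflTransGen.tail (b := Sum.inl (bx, bdy)) ?_
    ⟨⟨Or.inl rfl, Or.inl rfl⟩, Or.inr ⟨(bx, bdy), Sym2.mem_mk_left _ _, Or.inl rfl⟩⟩
  refine (exists_grid_segment (fun y => (ax, y)) (fun x y h => ?_) ay bdy).trans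
    (exists_grid_segment (fun x => (x, bdy)) (fun x y h => ?_) ax bx)
  · refine ⟨?_, Or.inl ⟨(ax, x), Sym2.mem_mk_left _ _, Or.inl rfl⟩⟩
    change Nat.dist ax ax + Nat.dist x y = 1
    rw [h, Nat.dist_self]
  · refine ⟨?_, Or.inr ⟨(x, bdy), Sym2.mem_mk_left _ _, Or.inr rfl⟩⟩
    change Nat.dist x y + Nat.dist bdy bdy = 1
    rw [h, Nat.dist_self]

open Classical in
/-- Every edge meets few crosses. -/
theorem card_meetsCross_le {d : ℕ} (e : Sym2 (GridVertex d)) :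
    (Finset.univ.filter fun a : InIdx d => MeetsCross a e).card ≤ 4 * ctrlSide d := by
  -- By injectivity of `cellCoord`, at most $k$ controls have their lower corner in a given column
  -- and at most $k$ in a given row. The two endpoints of an edge double the count.
  have hline : ∀ p : Fin (d ^ 3) × Fin (d ^ 3), (Finset.univ.filter fun a : InIdx d =>
      (p.1 : ℕ) = cellCoord d a.1 ∨ (p.2 : ℕ) = cellCoord d a.2).card ≤ 2 * ctrlSide d := by
    intro p
    rw [Finset.filter_or]
    refine (Finset.card_union_le _ _).trans ?_
    have h1 : (Finset.univ.filter fun a : InIdx d => (p.1 : ℕ) = cellCoord d a.1).card ≤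
        (Finset.univ : Finset (Fin (ctrlSide d))).card := by
      refine Finset.card_le_card_of_injOn Prod.snd
        (fun _ _ => Finset.mem_coe.mpr (Finset.mem_univ _)) ?_
      intro a ha b hb h
      simp only [Finset.coe_filter, Finset.mem_univ, true_and, Set.mem_ofPred_eq] at ha hb
      exact Prod.ext (cellCoord_injective (ha.symm.trans hb)) h
    have h2 : (Finset.univ.filter fun a : InIdx d => (p.2 : ℕ) = cellCoord d a.2).card ≤
        (Finset.univ : Finset (Fin (ctrlSide d))).card := by
      refine Finset.card_le_card_of_injOn Prod.fst
        (fun _ _ => Finset.mem_coe.mpr (Finset.mem_univ _)) ?_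
      intro a ha b hb h
      simp only [Finset.coe_filter, Finset.mem_univ, true_and, Set.mem_ofPred_eq] at ha hb
      exact Prod.ext h (cellCoord_injective (ha.symm.trans hb))
    rw [Finset.card_univ, Fintype.card_fin] at h1 h2
    omega
  have hvert : ∀ v : GridVertex d, (Finset.univ.filter fun a : InIdx d => ∃ p, Sum.inl p = v ∧
      ((p.1 : ℕ) = cellCoord d a.1 ∨ (p.2 : ℕ) = cellCoord d a.2)).card ≤ 2 * ctrlSide d := by
    rintro (p | u)
    · refine (Finset.card_le_card fun a ha => ?_).trans (hline p)
      simpa using ha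
    · simp
  induction e using Sym2.ind with
  | _ v w =>
    have hsub : (Finset.univ.filter fun a : InIdx d => MeetsCross a s(v, w)) ⊆
        (Finset.univ.filter fun a : InIdx d => ∃ p, Sum.inl p = v ∧
          ((p.1 : ℕ) = cellCoord d a.1 ∨ (p.2 : ℕ) = cellCoord d a.2)) ∪
        (Finset.univ.filter fun a : InIdx d => ∃ p, Sum.inl p = w ∧
          ((p.1 : ℕ) = cellCoord d a.1 ∨ (p.2 : ℕ) = cellCoord d a.2)) := by
      intro a ha
      obtain ⟨p, hp, h⟩ := (Finset.mem_filter.mp ha).2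
      rcases Sym2.mem_iff.mp hp with hp | hp
      · exact Finset.mem_union_left _ (Finset.mem_filter.mpr ⟨Finset.mem_univ _, p, hp, h⟩)
      · exact Finset.mem_union_right _ (Finset.mem_filter.mpr ⟨Finset.mem_univ _, p, hp, h⟩)
    have := (Finset.card_le_card hsub).trans (Finset.card_union_le _ _)
    have h1 := hvert v
    have h2 := hvert w
    omega

end Grid

/-! ## Classical shallow circuits fail -/

section LowerBound

open Classical in
/-- A sparse symmetric relation leaves some triple of elements pairwise unrelated. -/
theorem exists_unrelated_triple {α : Type} [Fintype α] (bad : α → α → Prop)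
    (h : 3 * (Finset.univ.filter fun p : α × α => bad p.1 p.2).card < Fintype.card α ^ 2) :
    ∃ a b c, ¬ bad a b ∧ ¬ bad a c ∧ ¬ bad b c := by
  by_contra! hcon
  set B := Finset.univ.filter fun p : α × α => bad p.1 p.2 with hB
  -- Otherwise every triple is a bad pair, in one of three positions, together with a free element,
  -- so there are at most $3|B||\alpha|$ triples.
  have hsub : (Finset.univ : Finset (α × α × α)) ⊆
      (B ×ˢ Finset.univ).map ⟨fun q : (α × α) × α => (q.1.1, q.1.2, q.2), by
        rintro ⟨⟨a, b⟩, c⟩ ⟨⟨a', b'⟩, c'⟩ h; simpa [and_assoc] using h⟩ ∪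
      ((B ×ˢ Finset.univ).map ⟨fun q : (α × α) × α => (q.1.1, q.2, q.1.2), by
        rintro ⟨⟨a, b⟩, c⟩ ⟨⟨a', b'⟩, c'⟩ h; simp_all⟩ ∪
      (B ×ˢ Finset.univ).map ⟨fun q : (α × α) × α => (q.2, q.1.1, q.1.2), by
        rintro ⟨⟨a, b⟩, c⟩ ⟨⟨a', b'⟩, c'⟩ h; simp_all⟩) := by
    rintro ⟨a, b, c⟩ -
    have hmem : ∀ {x y : α} (z : α), bad x y →
        ((x, y), z) ∈ B ×ˢ (Finset.univ : Finset α) := fun z h =>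
      Finset.mem_product.mpr ⟨Finset.mem_filter.mpr ⟨Finset.mem_univ _, h⟩, Finset.mem_univ _⟩
    by_cases h1 : bad a b
    · exact Finset.mem_union_left _ (Finset.mem_map.mpr ⟨_, hmem c h1, rfl⟩)
    by_cases h2 : bad a c
    · exact Finset.mem_union_right _ (Finset.mem_union_left _
        (Finset.mem_map.mpr ⟨_, hmem b h2, rfl⟩))
    · exact Finset.mem_union_right _ (Finset.mem_union_right _
        (Finset.mem_map.mpr ⟨_, hmem a (hcon a b c h1 h2), rfl⟩))
  have h1 := (Finset.card_le_card hsub).trans (Finset.card_union_le _ _)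
  have h2 := h1.trans (Nat.add_le_add_left (Finset.card_union_le _ _) _)
  simp only [Finset.card_map, Finset.card_product, Finset.card_univ, Fintype.card_prod] at h2
  have h3 : Fintype.card α * Fintype.card α ^ 2 ≤ Fintype.card α * (3 * B.card) := by
    calc _ = Fintype.card α * (Fintype.card α * Fintype.card α) := by ring
      _ ≤ _ := h2
      _ = _ := by ring
  have h4 : 0 < Fintype.card α := by
    rcases Nat.eq_zero_or_pos (Fintype.card α) with h0 | h0
    · simp [h0] at h
    · exact h0
  have := Nat.le_of_mul_le_mul_left h3 h4
  omega

variable {d : ℕ}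

/-- Two inputs interact if they coincide, if some output depends on both, or if one of them
influences an edge that meets the cross of the other. -/
def Interact (S : OutIdx d → Finset (InIdx d)) (a b : InIdx d) : Prop :=
  (a = b ∨ ∃ o, a ∈ S o ∧ b ∈ S o) ∨
    ((∃ e, MeetsCross a e.1 ∧ b ∈ S (Sum.inr e)) ∨ ∃ e, MeetsCross b e.1 ∧ a ∈ S (Sum.inr e))

open Classical in
theorem card_interact_le (S : OutIdx d → Finset (InIdx d)) {l : ℕ} (hl : ∀ o, (S o).card ≤ l) :
    (Finset.univ.filter fun p : InIdx d × InIdx d => Interact S p.1 p.2).card ≤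
      ctrlSide d ^ 2 + Fintype.card (OutIdx d) * l ^ 2 +
        2 * (Fintype.card (OutIdx d) * (4 * ctrlSide d * l)) := by
  have hN : Fintype.card (gridGraph d).edgeSet ≤ Fintype.card (OutIdx d) := by
    change _ ≤ Fintype.card (GridVertex d ⊕ (gridGraph d).edgeSet)
    rw [Fintype.card_sum]; omega
  have hsub : (Finset.univ.filter fun p : InIdx d × InIdx d => Interact S p.1 p.2) ⊆
      ((Finset.univ : Finset (InIdx d)).image (fun a => (a, a)) ∪
        (Finset.univ : Finset (OutIdx d)).biUnion fun o => S o ×ˢ S o) ∪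
      ((Finset.univ : Finset (gridGraph d).edgeSet).biUnion (fun e =>
        (Finset.univ.filter fun a : InIdx d => MeetsCross a e.1) ×ˢ S (Sum.inr e)) ∪
      (Finset.univ : Finset (gridGraph d).edgeSet).biUnion (fun e =>
        S (Sum.inr e) ×ˢ (Finset.univ.filter fun a : InIdx d => MeetsCross a e.1))) := by
    rintro ⟨a, b⟩ h
    obtain (hab | ⟨o, h1, h2⟩) | (⟨e, h1, h2⟩ | ⟨e, h1, h2⟩) := (Finset.mem_filter.mp h).2
    · exact Finset.mem_union_left _ (Finset.mem_union_left _
        (Finset.mem_image.mpr ⟨a, Finset.mem_univ _, Prod.ext rfl hab⟩))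
    · exact Finset.mem_union_left _ (Finset.mem_union_right _
        (Finset.mem_biUnion.mpr ⟨o, Finset.mem_univ _, Finset.mem_product.mpr ⟨h1, h2⟩⟩))
    · exact Finset.mem_union_right _ (Finset.mem_union_left _
        (Finset.mem_biUnion.mpr ⟨e, Finset.mem_univ _, Finset.mem_product.mpr
          ⟨Finset.mem_filter.mpr ⟨Finset.mem_univ _, h1⟩, h2⟩⟩))
    · exact Finset.mem_union_right _ (Finset.mem_union_right _
        (Finset.mem_biUnion.mpr ⟨e, Finset.mem_univ _, Finset.mem_product.mpr
          ⟨h2, Finset.mem_filter.mpr ⟨Finset.mem_univ _, h1⟩⟩⟩))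
  have b1 : ((Finset.univ : Finset (InIdx d)).image (fun a => (a, a))).card ≤ ctrlSide d ^ 2 := by
    refine Finset.card_image_le.trans ?_
    simp [sq]
  have b2 : ((Finset.univ : Finset (OutIdx d)).biUnion fun o => S o ×ˢ S o).card ≤
      Fintype.card (OutIdx d) * l ^ 2 := by
    refine Finset.card_biUnion_le_card_mul _ _ _ fun o _ => ?_
    rw [Finset.card_product, sq]
    exact Nat.mul_le_mul (hl o) (hl o)
  have b3 : ((Finset.univ : Finset (gridGraph d).edgeSet).biUnion (fun e =>
        (Finset.univ.filter fun a : InIdx d => MeetsCross a e.1) ×ˢ S (Sum.inr e))).card ≤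
      Fintype.card (OutIdx d) * (4 * ctrlSide d * l) := by
    refine (Finset.card_biUnion_le_card_mul _ _ (4 * ctrlSide d * l) fun e _ => ?_).trans
      (Nat.mul_le_mul_right _ hN)
    rw [Finset.card_product]
    exact Nat.mul_le_mul (card_meetsCross_le _) (hl _)
  have b4 : ((Finset.univ : Finset (gridGraph d).edgeSet).biUnion (fun e =>
        S (Sum.inr e) ×ˢ (Finset.univ.filter fun a : InIdx d => MeetsCross a e.1))).card ≤
      Fintype.card (OutIdx d) * (4 * ctrlSide d * l) := by
    refine (Finset.card_biUnion_le_card_mul _ _ (4 * ctrlSide d * l) fun e _ => ?_).trans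
      (Nat.mul_le_mul_right _ hN)
    rw [Finset.card_product, mul_comm (4 * ctrlSide d)]
    exact Nat.mul_le_mul (hl _) (card_meetsCross_le _)
  have t1 := Finset.card_union_le
    ((Finset.univ : Finset (InIdx d)).image (fun a => (a, a)))
    ((Finset.univ : Finset (OutIdx d)).biUnion fun o => S o ×ˢ S o)
  have t2 := Finset.card_union_le
    ((Finset.univ : Finset (gridGraph d).edgeSet).biUnion (fun e =>
        (Finset.univ.filter fun a : InIdx d => MeetsCross a e.1) ×ˢ S (Sum.inr e)))
    ((Finset.univ : Finset (gridGraph d).edgeSet).biUnion (fun e =>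
        S (Sum.inr e) ×ˢ (Finset.univ.filter fun a : InIdx d => MeetsCross a e.1)))
  have t3 := (Finset.card_le_card hsub).trans (Finset.card_union_le _ _)
  omega

/-- A map of small locality gives an invalid answer for one of the eight values of some three of
its inputs. -/
theorem exists_failing_triple (hd : 2 ≤ d) (F : (InIdx d → Bool) → OutIdx d → Bool)
    (S : OutIdx d → Finset (InIdx d)) (hS : ∀ o x y, (∀ i ∈ S o, x i = y i) → F x o = F y o)
    {l : ℕ} (hl : ∀ o, (S o).card ≤ l) (hlk : l ^ 4 ≤ ctrlSide d)
    (hk : 10000000 < ctrlSide d) :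
    ∃ a b c : InIdx d, ∀ A, ∃ α β γ, F (Function.update (Function.update
      (Function.update A a α) b β) c γ) ∉ validOutcomes d (Function.update (Function.update
      (Function.update A a α) b β) c γ) := by
  classical
  -- If $l\ge16$ then $k\ge l^4\ge 4096\,l$; otherwise the lower bound on $k$ is enough.
  have hlin : 4000 * l ≤ ctrlSide d := by
    by_contra! hlt
    have hl15 : l ≤ 15 := by
      by_contra! h16
      have h3 : 16 ^ 3 ≤ l ^ 3 := Nat.pow_le_pow_left h16 3
      have : l ^ 4 = l * l ^ 3 := by ring
      nlinarith
    omega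
  -- The dominant term of the pair count is $2\cdot130k^2\cdot4kl=1040k^3l$. Three times this is at
  -- most $0.78\,k^4$ by `hlin`, and the other terms are of order at most $k^3$.
  have hcount : 3 * (Finset.univ.filter fun p : InIdx d × InIdx d => Interact S p.1 p.2).card <
      Fintype.card (InIdx d) ^ 2 := by
    have h1 := card_interact_le S hl
    have hN := card_outIdx_le hd
    have h2 : l ^ 2 ≤ ctrlSide d := by nlinarith
    have hcard : Fintype.card (InIdx d) = ctrlSide d ^ 2 := by simp [sq]
    rw [hcard]
    generalize Fintype.card (OutIdx d) = N at h1 hN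
    generalize (Finset.univ.filter fun p : InIdx d × InIdx d => Interact S p.1 p.2).card = B at h1 ⊢
    clear hS hl hcard
    generalize ctrlSide d = k at *
    have e1 : N * l ^ 2 ≤ 130 * k ^ 2 * k := Nat.mul_le_mul hN h2
    have e2 : N * (4 * k * (4000 * l)) ≤ 130 * k ^ 2 * (4 * k * k) :=
      Nat.mul_le_mul hN (Nat.mul_le_mul_left _ hlin)
    have e3 : 1000 * k ^ 3 ≤ k * k ^ 3 := Nat.mul_le_mul_right _ (by omega)
    have e4 : 1000 * k ^ 2 ≤ k * k ^ 2 := Nat.mul_le_mul_right _ (by omega)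
    have e5 : 0 < k ^ 3 := by positivity
    nlinarith
  obtain ⟨a, b, c, hab, hac, hbc⟩ := exists_unrelated_triple (Interact S) hcount
  simp only [Interact, not_or, not_exists, not_and] at hab hac hbc
  refine ⟨a, b, c, fun A => ?_⟩
  have hreach : ∀ a b c : InIdx d,
      (∀ e : (gridGraph d).edgeSet, MeetsCross a e.1 → c ∉ S (Sum.inr e)) →
      (∀ e : (gridGraph d).edgeSet, MeetsCross b e.1 → c ∉ S (Sum.inr e)) →
      ReachAvoiding (gridGraph d) S c (Sum.inr a) (Sum.inr b) := by
    intro a b c ha hb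
    refine Relation.ReflTransGen.mono (fun v w h => ⟨h.1, ?_⟩) _ _ (exists_path_in_crosses a b)
    rcases h.2 with h2 | h2
    · exact ha ⟨s(v, w), h.1⟩ h2
    · exact hb ⟨s(v, w), h.1⟩ h2
  obtain ⟨α, β, γ, hfail⟩ := exists_parity_violation (gridGraph d) F S hS hab.1.1 hac.1.1 hbc.1.1
    hab.1.2 hac.1.2 hbc.1.2
    (fun u =>
      Relation.ReflTransGen.mono (fun v w h => h.1) _ _ (exists_path_in_crosses a u))
    (hreach a b c hac.2.1 hbc.2.1) (hreach a c b hab.2.1 hbc.2.2)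
    (hreach b c a hab.2.2 hac.2.2) A
  refine ⟨α, β, γ, fun hvalid => hfail _ rfl ?_⟩
  obtain ⟨y, hy1, hy2⟩ := exists_potential_of_measureProb_pos (gridGraph d) _ _
    (fun e => rfl) hvalid
  refine ⟨y, hy1, fun t ht => ?_⟩
  -- Only control vertices are measured in the $Y$-basis, so the number of such measurements is the
  -- weight of the input.
  have h := hy2 t (by
    rw [Fintype.sum_sum_type, ← ht]
    simp [basisChoice])
  rw [Fintype.sum_sum_type (fun v : GridVertex d => if basisChoice d _ (Sum.inl v) then
    (y v).toNat else 0)] at h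
  simp only [basisChoice, Fintype.sum_sum_type, Bool.false_eq_true, if_false,
    Finset.sum_const_zero, zero_add] at h ⊢
  convert h using 4
  exact if_congr Iff.rfl rfl rfl

open Classical in
/-- If every input can be made to fail by changing three fixed bits, at least one input out of
eight fails. -/
theorem card_success_le {α : Type} [Fintype α] [DecidableEq α] (good : (α → Bool) → Prop)
    (a b c : α) (h : ∀ A, ∃ β₁ β₂ β₃, ¬ good (Function.update (Function.update
      (Function.update A a β₁) b β₂) c β₃)) :
    8 * (Finset.univ.filter good).card ≤ 7 * 2 ^ Fintype.card α := by
  choose β₁ β₂ β₃ hβ using h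
  -- An input is recovered from its failing modification and its three original bits, so at most
  -- eight inputs share one failure.
  have hinj : (Finset.univ : Finset (α → Bool)).card ≤
      ((Finset.univ.filter fun A => ¬ good A) ×ˢ
        (Finset.univ : Finset (Bool × Bool × Bool))).card := by
    refine Finset.card_le_card_of_injOn (fun A => (Function.update (Function.update
      (Function.update A a (β₁ A)) b (β₂ A)) c (β₃ A), (A a, A b, A c))) ?_ ?_
    · intro A _
      exact Finset.mem_product.mpr ⟨Finset.mem_filter.mpr ⟨Finset.mem_univ _, hβ A⟩,
        Finset.mem_univ _⟩
    · intro A _ A' _ hAA'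
      simp only [Prod.mk.injEq] at hAA'
      obtain ⟨h1, ha, hb, hc⟩ := hAA'
      funext i
      by_cases hic : i = c
      · rw [hic, hc]
      by_cases hib : i = b
      · rw [hib, hb]
      by_cases hia : i = a
      · rw [hia, ha]
      simpa [hic, hib, hia] using congrFun h1 i
  have hcompl := Finset.card_filter_add_card_filter_not
    (s := (Finset.univ : Finset (α → Bool))) good
  simp only [Finset.card_product, Finset.card_univ, Fintype.card_prod, Fintype.card_bool,
    Fintype.card_fun] at hinj hcompl
  omega

/-- The average success probability of a randomized circuit of small depth is at most `7/8`. -/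
theorem average_success_le (hd : 2 ≤ d) (hk : 10000000 < ctrlSide d) {K : ℕ} (hK : 2 ≤ K)
    (C : RandCircuit (InIdx d) (OutIdx d)) (hC : C.circuit.FaninLE K)
    (hdepth : (K ^ C.circuit.depth) ^ 4 ≤ ctrlSide d) :
    ∑ A : InIdx d → Bool, C.prob A (answers (rel d) A) ≤ 7 / 8 * 2 ^ (ctrlSide d ^ 2) := by
  classical
  have hfix : ∀ r : Fin C.rand → Bool, (∑ A : InIdx d → Bool,
      if C.circuit.eval (Sum.elim A r) ∈ answers (rel d) A then (1 : ℝ) else 0) ≤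
      7 / 8 * 2 ^ (ctrlSide d ^ 2) := by
    intro r
    obtain ⟨S, hS⟩ := C.exists_cones (by omega) hC r
    obtain ⟨a, b, c, habc⟩ := exists_failing_triple hd
      (fun A => C.circuit.eval (Sum.elim A r)) S (fun o => (hS o).2) (fun o => (hS o).1) hdepth hk
    have h := card_success_le
      (fun A => C.circuit.eval (Sum.elim A r) ∈ answers (rel d) A) a b c habc
    have hcard : Fintype.card (InIdx d) = ctrlSide d ^ 2 := by simp [sq]
    rw [hcard] at h
    rw [Finset.sum_boole]
    have h' : (8 : ℝ) * (Finset.univ.filter fun A : InIdx d → Bool =>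
        C.circuit.eval (Sum.elim A r) ∈ answers (rel d) A).card ≤ 7 * 2 ^ (ctrlSide d ^ 2) := by
      exact_mod_cast h
    linarith
  have hone : ∑ r, (C.dist r).toReal = 1 := by
    rw [← ENNReal.toReal_sum fun r _ => C.dist.apply_ne_top r,
      ← tsum_fintype (L := .unconditional _), C.dist.tsum_coe, ENNReal.toReal_one]
  calc ∑ A : InIdx d → Bool, C.prob A (answers (rel d) A)
      = ∑ r, (C.dist r).toReal * ∑ A : InIdx d → Bool,
          if C.circuit.eval (Sum.elim A r) ∈ answers (rel d) A then (1 : ℝ) else 0 := by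
        simp only [RandCircuit.prob]
        rw [Finset.sum_comm]
        refine Finset.sum_congr rfl fun r _ => ?_
        rw [Finset.mul_sum]
        refine Finset.sum_congr rfl fun A _ => ?_
        split_ifs <;> simp
    _ ≤ ∑ r, (C.dist r).toReal * (7 / 8 * 2 ^ (ctrlSide d ^ 2)) :=
        Finset.sum_le_sum fun r _ => mul_le_mul_of_nonneg_left (hfix r) ENNReal.toReal_nonneg
    _ = 7 / 8 * 2 ^ (ctrlSide d ^ 2) := by rw [← Finset.sum_mul, hone, one_mul]

/-- As $m=k^2$, the depth bound reads $D\le\frac14\log_K k$. The proof compares squares, which keeps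
all exponents integral. -/
theorem pow_depth_le {K D k : ℕ} (hK : 2 ≤ K) (hk : 0 < k)
    (h : (D : ℝ) ≤ 1 / 8 * Real.logb K ((k ^ 2 : ℕ) : ℝ)) : (K ^ D) ^ 4 ≤ k := by
  have hK1 : (1 : ℝ) < K := by exact_mod_cast hK
  have h8 : ((8 * D : ℕ) : ℝ) ≤ Real.logb K ((k ^ 2 : ℕ) : ℝ) := by push_cast at h ⊢; linarith
  rw [Real.le_logb_iff_rpow_le hK1 (by positivity), Real.rpow_natCast] at h8
  have h9 : K ^ (8 * D) ≤ k ^ 2 := by exact_mod_cast h8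
  have h10 : ((K ^ D) ^ 4) ^ 2 ≤ k ^ 2 := by
    calc ((K ^ D) ^ 4) ^ 2 = K ^ (8 * D) := by rw [← pow_mul, ← pow_mul]; congr 1; ring
      _ ≤ _ := h9
  exact (Nat.pow_le_pow_iff_left two_ne_zero).mp h10

/-- Randomized classical circuits of depth at most `1/8 * log_K m` fail on average. -/
theorem classical_lower_bound (d : ℕ) (hd : 1000 ≤ d) (K : ℕ) (hK : 2 ≤ K)
    (C : RandCircuit (InIdx d) (OutIdx d)) (hC : C.circuit.FaninLE K)
    (hdepth : (C.circuit.depth : ℝ) ≤ 1 / 8 * Real.logb K ((ctrlSide d ^ 2 : ℕ) : ℝ)) :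
    1 / (2 : ℝ) ^ (ctrlSide d ^ 2) *
      ∑ A : InIdx d → Bool, C.prob A (answers (rel d) A) < 15 / 16 := by
  have hk : 10000000 < ctrlSide d := by
    have h1 : 1000 ^ 2 ≤ d ^ 2 := Nat.pow_le_pow_left hd 2
    have h2 : 999 ≤ d - 1 := by omega
    calc 10000000 < 1000 ^ 2 * 999 := by norm_num
      _ ≤ d ^ 2 * (d - 1) := Nat.mul_le_mul h1 h2
  have h := average_success_le (by omega) hk hK C hC (pow_depth_le hK (by omega) hdepth)
  have hpos : (0 : ℝ) < 2 ^ (ctrlSide d ^ 2) := by positivity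
  rw [one_div, inv_mul_lt_iff₀ hpos]
  linarith

end LowerBound

/-! ## Products of one-qubit operators -/

section TensorOp

theorem tensorOp_conjTranspose {Q : Type} [Fintype Q] (U : Q → Matrix Bool Bool ℂ) :
    (tensorOp U).conjTranspose = tensorOp fun q => (U q).conjTranspose := by
  ext x y
  simp [tensorOp, Matrix.conjTranspose_apply]

theorem tensorOp_one {Q : Type} [Fintype Q] :
    tensorOp (fun _ : Q => (1 : Matrix Bool Bool ℂ)) = 1 := by
  ext x y
  rw [tensorOp, Matrix.one_apply]
  split_ifs with h
  · subst h
    exact Finset.prod_eq_one fun q _ => Matrix.one_apply_eq _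
  · obtain ⟨q, hq⟩ := Function.ne_iff.mp h
    exact Finset.prod_eq_zero (Finset.mem_univ q) (Matrix.one_apply_ne hq)

variable {Q : Type} [Fintype Q] [DecidableEq Q]

theorem tensorOp_mul (U W : Q → Matrix Bool Bool ℂ) :
    tensorOp U * tensorOp W = tensorOp fun q => U q * W q := by
  ext x y
  simp only [Matrix.mul_apply, tensorOp, Finset.prod_univ_sum, Fintype.piFinset_univ,
    Finset.prod_mul_distrib]

theorem tensorOp_isometry {U : Q → Matrix Bool Bool ℂ}
    (hU : ∀ q, U q ∈ Matrix.unitaryGroup Bool ℂ) :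
    (tensorOp U).conjTranspose * tensorOp U = 1 := by
  rw [tensorOp_conjTranspose, tensorOp_mul, ← tensorOp_one]
  congr 1
  funext q
  exact (Matrix.mem_unitaryGroup_iff').mp (hU q)

theorem sum_norm_sq_mulVec {n : Type} [Fintype n] [DecidableEq n] {M : Matrix n n ℂ}
    (hM : M.conjTranspose * M = 1) (v : n → ℂ) :
    ∑ i, ‖M.mulVec v i‖ ^ 2 = ∑ i, ‖v i‖ ^ 2 := by
  have key : ∀ w : n → ℂ, ((∑ i, ‖w i‖ ^ 2 : ℝ) : ℂ) = star w ⬝ᵥ w := by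
    intro w
    simp only [dotProduct, Pi.star_apply, RCLike.star_def, Complex.conj_mul']
    push_cast
    rfl
  apply Complex.ofReal_injective
  rw [key, key, Matrix.star_mulVec, ← Matrix.dotProduct_mulVec, Matrix.mulVec_mulVec, hM,
    Matrix.one_mulVec]

theorem hadamard_unitary : hadamard ∈ Matrix.unitaryGroup Bool ℂ := by
  have h2 : ((Real.sqrt 2 : ℝ) : ℂ) ^ 2 = 2 := by
    norm_cast
    exact Real.sq_sqrt (by norm_num)
  rw [Matrix.mem_unitaryGroup_iff]
  ext a b
  cases a <;> cases b <;>
    simp [hadamard, Matrix.mul_apply, Matrix.star_apply, ← sq, h2]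
  all_goals norm_num

theorem yGate_unitary : yGate ∈ Matrix.unitaryGroup Bool ℂ := by
  have h2 : ((Real.sqrt 2 : ℝ) : ℂ) ^ 2 = 2 := by
    norm_cast
    exact Real.sq_sqrt (by norm_num)
  have h3 : ((Real.sqrt 2 : ℝ) : ℂ) ≠ 0 := by
    intro h; simp [h] at h2
  rw [Matrix.mem_unitaryGroup_iff]
  ext a b
  cases a <;> cases b <;>
    simp [yGate, Matrix.mul_apply, Matrix.star_apply] <;> field_simp <;>
    simp [h2] <;> norm_num

theorem measureOp_unitary (f : Bool) :
    (if f then yGate else hadamard) ∈ Matrix.unitaryGroup Bool ℂ := by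
  cases f
  · exact hadamard_unitary
  · exact yGate_unitary

/-- The outcome probabilities of a measurement of a graph state add up to one. -/
theorem sum_measureProb_graphState (G : SimpleGraph Q) [DecidableRel G.Adj] (f : Q → Bool) :
    ∑ z, measureProb (graphState G) f z = 1 := by
  simp only [measureProb]
  rw [sum_norm_sq_mulVec (tensorOp_isometry fun q => measureOp_unitary (f q)), graphState]
  have hcz : ∀ (e : Sym2 Q) x, ‖czPhase e x‖ = 1 := by
    intro e x
    unfold czPhase
    split_ifs <;> simp
  simp only [Matrix.mulVec_diagonal, norm_mul, norm_prod, hcz, Finset.prod_const_one, one_mul]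
  rw [sum_norm_sq_mulVec (tensorOp_isometry fun q => hadamard_unitary)]
  rw [Finset.sum_eq_single (fun _ => false)]
  · simp [ket]
  · intro b _ hb
    simp [ket, hb]
  · simp

/-- A one-qubit operator applied to one qubit of a state. -/
def localOp (U : Matrix Bool Bool ℂ) (a : Q) (φ : (Q → Bool) → ℂ) : (Q → Bool) → ℂ :=
  fun z => ∑ b, U (z a) b * φ (Function.update z a b)

theorem localOp_tensorOp (U : Matrix Bool Bool ℂ) (a : Q) (W : Q → Matrix Bool Bool ℂ)
    (hW : W a = 1) (φ : (Q → Bool) → ℂ) :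
    localOp U a ((tensorOp W).mulVec φ) = (tensorOp (Function.update W a U)).mulVec φ := by
  funext z
  simp only [localOp, Matrix.mulVec, dotProduct, Finset.mul_sum]
  rw [Finset.sum_comm]
  refine Finset.sum_congr rfl fun y _ => ?_
  simp only [tensorOp, ← mul_assoc]
  rw [← Finset.sum_mul]
  congr 1
  have h1 : ∀ b, ∏ q, W q (Function.update z a b q) (y q) =
      (if b = y a then 1 else 0) * ∏ q ∈ Finset.univ.erase a, W q (z q) (y q) := by
    intro b
    rw [← Finset.mul_prod_erase _ _ (Finset.mem_univ a), Function.update_self, hW,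
      Matrix.one_apply]
    congr 1
    refine Finset.prod_congr rfl fun q hq => ?_
    rw [Function.update_of_ne (Finset.ne_of_mem_erase hq)]
  simp only [h1, ← mul_assoc]
  rw [← Finset.sum_mul, ← Finset.mul_prod_erase _ _ (Finset.mem_univ a), Function.update_self]
  congr 1
  · simp
  · refine Finset.prod_congr rfl fun q hq => ?_
    rw [Function.update_of_ne (Finset.ne_of_mem_erase hq)]

/-- This matches a layer, given as a list of gates applied one after another, with the tensor
product in `measureProb` and `graphState`. -/
theorem foldr_localOp (U : Q → Matrix Bool Bool ℂ) (φ : (Q → Bool) → ℂ) :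
    (Finset.univ : Finset Q).toList.foldr (fun a ψ => localOp (U a) a ψ) φ =
      (tensorOp U).mulVec φ := by
  have h : ∀ l : List Q, l.Nodup → l.foldr (fun a ψ => localOp (U a) a ψ) φ =
      (tensorOp fun q => if q ∈ l then U q else 1).mulVec φ := by
    intro l hl
    induction l with
    | nil =>
      simp [tensorOp_one]
    | cons a l ih =>
      rw [List.nodup_cons] at hl
      rw [List.foldr_cons, ih hl.2, localOp_tensorOp _ _ _ (by simp [hl.1])]
      congr 2
      funext q
      by_cases hq : q = a
      · subst hq; simp
      · simp [hq]
  rw [h _ (Finset.nodup_toList _)]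
  simp

end TensorOp

/-! ## Gates with one target -/

section Gates

variable {Q : Type} [Fintype Q] [DecidableEq Q]

theorem sum_agree_off (t : Q) (x : Q → Bool) (f : (Q → Bool) → ℂ) :
    (∑ y, if ∀ q, q ≠ t → x q = y q then f y else 0) = ∑ b, f (Function.update x t b) := by
  rw [← Finset.sum_filter]
  symm
  refine Finset.sum_bij (fun b _ => Function.update x t b) ?_ ?_ ?_ ?_
  · intro b _
    simp +contextual
  · intro b _ b' _ h
    simpa using congrFun h t
  · intro y hy
    refine ⟨y t, Finset.mem_univ _, ?_⟩
    funext q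
    by_cases hq : q = t
    · subst hq; simp
    · rw [Function.update_of_ne hq]
      exact (Finset.mem_filter.mp hy).2 q hq
  · intros; rfl

/-- The operator acting on the target `t` by a matrix that depends on the other qubits. -/
def targetMatrix (t : Q) (U : (Q → Bool) → Matrix Bool Bool ℂ) : Matrix (Q → Bool) (Q → Bool) ℂ :=
  fun x y => if ∀ q, q ≠ t → x q = y q then U x (x t) (y t) else 0

theorem targetMatrix_mulVec (t : Q) (U : (Q → Bool) → Matrix Bool Bool ℂ)
    (ψ : (Q → Bool) → ℂ) (x : Q → Bool) :
    (targetMatrix t U).mulVec ψ x = ∑ b, U x (x t) b * ψ (Function.update x t b) := by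
  simp only [Matrix.mulVec, dotProduct, targetMatrix, ite_mul, zero_mul]
  rw [sum_agree_off t x (fun y => U x (x t) (y t) * ψ y)]
  simp

/-- The matrix is block diagonal with one $2\times2$ unitary block per assignment of the other
qubits; `ht` says that the block does not depend on the target bit. -/
theorem targetMatrix_unitary (t : Q) (U : (Q → Bool) → Matrix Bool Bool ℂ)
    (hU : ∀ x, U x ∈ Matrix.unitaryGroup Bool ℂ) (ht : ∀ x b, U (Function.update x t b) = U x) :
    targetMatrix t U ∈ Matrix.unitaryGroup (Q → Bool) ℂ := by
  rw [Matrix.mem_unitaryGroup_iff]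
  ext x z
  rw [Matrix.mul_apply]
  have h1 : (∑ y, targetMatrix t U x y * star (targetMatrix t U) y z) =
      (targetMatrix t U).mulVec (fun y => star (targetMatrix t U z y)) x := rfl
  rw [h1, targetMatrix_mulVec]
  by_cases hxz : ∀ q, q ≠ t → x q = z q
  · have hz : z = Function.update x t (z t) := by
      funext q
      by_cases hq : q = t
      · subst hq; simp
      · rw [Function.update_of_ne hq, hxz q hq]
    have hUz : U z = U x := by rw [hz, ht]
    have h2 : ∀ b, targetMatrix t U z (Function.update x t b) = U x (z t) b := by
      intro b
      unfold targetMatrix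
      rw [if_pos, Function.update_self, hUz]
      intro q hq
      rw [Function.update_of_ne hq, hxz q hq]
    simp only [h2]
    have h3 := congrFun (congrFun ((Matrix.mem_unitaryGroup_iff).mp (hU x)) (x t)) (z t)
    rw [Matrix.mul_apply] at h3
    refine h3.trans ?_
    rw [Matrix.one_apply, Matrix.one_apply]
    refine if_congr ⟨fun h => ?_, fun h => by rw [h]⟩ rfl rfl
    rw [hz, ← h, Function.update_eq_self]
  · have h2 : ∀ b, targetMatrix t U z (Function.update x t b) = 0 := by
      intro b
      unfold targetMatrix
      rw [if_neg]
      intro h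
      apply hxz
      intro q hq
      rw [h q hq, Function.update_of_ne hq]
    simp only [h2, star_zero, mul_zero, Finset.sum_const_zero]
    rw [Matrix.one_apply_ne]
    rintro rfl
    exact hxz fun _ _ => rfl

/-- The gate on `S` acting on the target `t` by a matrix that depends on the other qubits of `S`. -/
def targetGate (S : Finset Q) (t : Q) (ht : t ∈ S) (U : (S → Bool) → Matrix Bool Bool ℂ)
    (hU : ∀ x, U x ∈ Matrix.unitaryGroup Bool ℂ)
    (hUt : ∀ x b, U (Function.update x ⟨t, ht⟩ b) = U x) : QGate Q where
  support := S
  mat := targetMatrix ⟨t, ht⟩ U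
  unitary := targetMatrix_unitary _ U hU hUt

theorem targetGate_mulVec (S : Finset Q) (t : Q) (ht : t ∈ S) (U : (S → Bool) → Matrix Bool Bool ℂ)
    (hU : ∀ x, U x ∈ Matrix.unitaryGroup Bool ℂ)
    (hUt : ∀ x b, U (Function.update x ⟨t, ht⟩ b) = U x) (ψ : (Q → Bool) → ℂ) (x : Q → Bool) :
    (targetGate S t ht U hU hUt).toMatrix.mulVec ψ x =
      ∑ b, U (fun q => x q) (x t) b * ψ (Function.update x t b) := by
  rw [← targetMatrix_mulVec t (fun x => U fun q => x q)]
  congr 2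
  ext x y
  simp only [QGate.toMatrix, targetGate, targetMatrix]
  by_cases h : ∀ q, q ≠ t → x q = y q
  · rw [if_pos h, if_pos, if_pos]
    · intro q hq
      exact h q fun h => hq (Subtype.ext h)
    · intro q hq
      exact h q fun h => hq (h ▸ ht)
  · rw [if_neg h]
    by_cases h1 : ∀ q, q ∉ S → x q = y q
    · rw [if_pos h1, if_neg]
      intro h2
      apply h
      intro q hq
      by_cases hqS : q ∈ S
      · exact h2 ⟨q, hqS⟩ fun h => hq (congrArg Subtype.val h)
      · exact h1 q hqS
    · rw [if_neg h1]

/-- A one-qubit gate. -/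
def oneGate (t : Q) (U : Matrix Bool Bool ℂ) (hU : U ∈ Matrix.unitaryGroup Bool ℂ) : QGate Q :=
  targetGate {t} t (Finset.mem_singleton_self t) (fun _ => U) (fun _ => hU) fun _ _ => rfl

/-- The gate applying `U b` to the target `t` when the control `c` has value `b`. -/
def ctrlGate (c t : Q) (hct : c ≠ t) (U : Bool → Matrix Bool Bool ℂ)
    (hU : ∀ b, U b ∈ Matrix.unitaryGroup Bool ℂ) : QGate Q :=
  targetGate {c, t} t (by simp) (fun x => U (x ⟨c, by simp⟩)) (fun _ => hU _) fun x b => by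
    rw [Function.update_of_ne]
    simpa using hct

theorem oneGate_mulVec (t : Q) (U : Matrix Bool Bool ℂ) (hU : U ∈ Matrix.unitaryGroup Bool ℂ)
    (ψ : (Q → Bool) → ℂ) (x : Q → Bool) :
    (oneGate t U hU).toMatrix.mulVec ψ x = ∑ b, U (x t) b * ψ (Function.update x t b) :=
  targetGate_mulVec _ _ _ _ _ _ _ _

theorem ctrlGate_mulVec (c t : Q) (hct : c ≠ t) (U : Bool → Matrix Bool Bool ℂ)
    (hU : ∀ b, U b ∈ Matrix.unitaryGroup Bool ℂ) (ψ : (Q → Bool) → ℂ) (x : Q → Bool) :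
    (ctrlGate c t hct U hU).toMatrix.mulVec ψ x =
      ∑ b, U (x c) (x t) b * ψ (Function.update x t b) :=
  targetGate_mulVec _ _ _ _ _ _ _ _

/-- The blocks of a Controlled-`Z` gate. -/
def czBlock (b : Bool) : Matrix Bool Bool ℂ :=
  Matrix.diagonal fun a => if b && a then -1 else 1

theorem czBlock_unitary (b : Bool) : czBlock b ∈ Matrix.unitaryGroup Bool ℂ := by
  rw [Matrix.mem_unitaryGroup_iff, Matrix.star_eq_conjTranspose, czBlock,
    Matrix.diagonal_conjTranspose, Matrix.diagonal_mul_diagonal, ← Matrix.diagonal_one]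
  congr 1
  funext a
  cases a <;> cases b <;> simp

theorem czGate_mulVec (c t : Q) (hct : c ≠ t) (ψ : (Q → Bool) → ℂ) (x : Q → Bool) :
    (ctrlGate c t hct czBlock czBlock_unitary).toMatrix.mulVec ψ x =
      czPhase s(c, t) x * ψ x := by
  rw [ctrlGate_mulVec, Finset.sum_eq_single (x t)]
  · rw [Function.update_eq_self, czBlock, Matrix.diagonal_apply_eq]
    simp [czPhase]
  · intro b _ hb
    rw [czBlock, Matrix.diagonal_apply_ne _ hb.symm, zero_mul]
  · simp

end Gates

/-! ## A quantum circuit of constant depth -/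

section Embedded

variable {ι o Q : Type}

/-- The state `|A⟩ ⊗ φ`, where `|A⟩` is on the input qubits and `φ` on the output qubits. -/
noncomputable def embedState [Fintype ι] (e : ι ⊕ o ≃ Q) (A : ι → Bool) (φ : (o → Bool) → ℂ) :
    (Q → Bool) → ℂ :=
  fun x => if ∀ i, x (e (Sum.inl i)) = A i then φ fun a => x (e (Sum.inr a)) else 0

theorem embedState_ket [Fintype ι] [Fintype o] [Fintype Q] [DecidableEq o] [DecidableEq Q]
    (e : ι ⊕ o ≃ Q) (A : ι → Bool) (x₀ : Q → Bool)
    (h₁ : ∀ i, x₀ (e (Sum.inl i)) = A i) (h₂ : ∀ a, x₀ (e (Sum.inr a)) = false) :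
    ket x₀ = embedState e A (ket fun _ => false) := by
  funext x
  by_cases hx : x = x₀
  · subst hx
    have h3 : (fun a => x (e (Sum.inr a))) = fun _ => false := funext h₂
    simp [embedState, h₁, ket, h3]
  · rw [embedState]
    split_ifs with h
    · rw [ket, Pi.single_eq_of_ne hx, ket, Pi.single_eq_of_ne]
      intro h3
      apply hx
      funext q
      obtain ⟨s, rfl⟩ := e.surjective q
      rcases s with i | a
      · rw [h, h₁]
      · rw [h₂]; exact congrFun h3 a
    · rw [ket, Pi.single_eq_of_ne hx]

theorem sum_norm_sq_embedState [Fintype ι] [Fintype o] [Fintype Q] [DecidableEq ι] [DecidableEq o]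
    [DecidableEq Q]
    (e : ι ⊕ o ≃ Q) (A : ι → Bool) (φ : (o → Bool) → ℂ) :
    ∑ x, ‖embedState e A φ x‖ ^ 2 = ∑ z, ‖φ z‖ ^ 2 := by
  rw [← (Equiv.arrowCongr e (Equiv.refl Bool)).sum_comp,
    ← (Equiv.sumArrowEquivProdArrow ι o Bool).symm.sum_comp, Fintype.sum_prod_type,
    Finset.sum_eq_single A]
  · refine Finset.sum_congr rfl fun z _ => ?_
    simp [embedState]
  · intro B _ hB
    refine Finset.sum_eq_zero fun z _ => ?_
    obtain ⟨i, hi⟩ := Function.ne_iff.mp hB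
    rw [embedState, if_neg]
    · simp
    · intro h
      exact hi (by simpa using h i)
  · simp

/-- The input register stays in a basis state, so a gate whose block is selected by input qubits
acts on the output register as one fixed matrix. -/
theorem embedState_localOp [Fintype ι] [DecidableEq o] [DecidableEq Q]
    (e : ι ⊕ o ≃ Q) (A : ι → Bool) (a : o)
    (U : (Q → Bool) → Matrix Bool Bool ℂ) (W : Matrix Bool Bool ℂ)
    (hU : ∀ x : Q → Bool, (∀ i, x (e (Sum.inl i)) = A i) → U x = W) (φ : (o → Bool) → ℂ) :
    (fun x => ∑ b, U x (x (e (Sum.inr a))) b *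
      embedState e A φ (Function.update x (e (Sum.inr a)) b)) =
      embedState e A (localOp W a φ) := by
  funext x
  have h1 : ∀ b, (∀ i, Function.update x (e (Sum.inr a)) b (e (Sum.inl i)) = A i) ↔
      ∀ i, x (e (Sum.inl i)) = A i := by
    intro b
    refine forall_congr' fun i => ?_
    rw [Function.update_of_ne]
    simp
  have h2 : ∀ b, (fun a' => Function.update x (e (Sum.inr a)) b (e (Sum.inr a'))) =
      Function.update (fun a' => x (e (Sum.inr a'))) a b := by
    intro b
    funext a'
    by_cases h : a' = a
    · subst h; simp
    · rw [Function.update_of_ne h, Function.update_of_ne]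
      simpa using h
  simp only [embedState, h1, h2]
  split_ifs with h
  · simp [localOp, hU x h]
  · simp

/-- A layer whose gates act on the output qubits by operators `T k`. -/
theorem foldr_embedState {κ : Type} [Fintype ι] [Fintype Q] [DecidableEq Q]
    (e : ι ⊕ o ≃ Q) (A : ι → Bool) (g : κ → QGate Q)
    (T : κ → ((o → Bool) → ℂ) → (o → Bool) → ℂ)
    (h : ∀ k φ, (g k).toMatrix.mulVec (embedState e A φ) = embedState e A (T k φ)) (l : List κ)
    (φ : (o → Bool) → ℂ) :
    ((l.map g).map QGate.toMatrix).prod.mulVec (embedState e A φ) =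
      embedState e A (l.foldr T φ) := by
  induction l with
  | nil => simp
  | cons k l ih =>
    rw [List.map_cons, List.map_cons, List.prod_cons, ← Matrix.mulVec_mulVec, ih, h,
      List.foldr_cons]

theorem foldr_mul_phase {κ : Type} (c : κ → (o → Bool) → ℂ) (l : List κ) (φ : (o → Bool) → ℂ) :
    l.foldr (fun k ψ z => c k z * ψ z) φ = fun z => (l.map fun k => c k z).prod * φ z := by
  induction l with
  | nil => simp
  | cons k l ih => simp [ih, mul_assoc]

theorem foldl_mul_phase {κ : Type} [Fintype ι] [Fintype Q] [DecidableEq Q]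
    (e : ι ⊕ o ≃ Q) (A : ι → Bool) (L : κ → QLayer Q)
    (c : κ → (o → Bool) → ℂ)
    (h : ∀ k φ, (L k).toMatrix.mulVec (embedState e A φ) =
      embedState e A fun z => c k z * φ z) (l : List κ) (φ : (o → Bool) → ℂ) :
    (l.map L).foldl (fun ψ L => L.toMatrix.mulVec ψ) (embedState e A φ) =
      embedState e A fun z => (l.map fun k => c k z).prod * φ z := by
  induction l generalizing φ with
  | nil => simp
  | cons k l ih =>
    rw [List.map_cons, List.foldl_cons, h, ih]
    congr 1
    funext z
    rw [List.map_cons, List.prod_cons]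
    ring

/-- One-qubit gates on all output qubits. -/
noncomputable def hadamardLayer [Fintype o] [DecidableEq Q]
    (e : ι ⊕ o ≃ Q) : QLayer Q where
  gates := (Finset.univ : Finset o).toList.map fun a =>
    oneGate (e (Sum.inr a)) hadamard hadamard_unitary
  disjoint := by
    rw [List.pairwise_map]
    refine (Finset.nodup_toList _).imp fun {a b} hab => ?_
    simpa [oneGate, targetGate] using hab

theorem hadamardLayer_mulVec [Fintype ι] [Fintype o] [Fintype Q] [DecidableEq o] [DecidableEq Q]
    (e : ι ⊕ o ≃ Q) (A : ι → Bool) (φ : (o → Bool) → ℂ) :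
    (hadamardLayer e).toMatrix.mulVec (embedState e A φ) =
      embedState e A ((tensorOp fun _ => hadamard).mulVec φ) := by
  rw [← foldr_localOp]
  refine foldr_embedState e A _ (fun a => localOp hadamard a) (fun a φ => ?_) _ φ
  rw [← embedState_localOp e A a (fun _ => hadamard) hadamard fun _ _ => rfl]
  funext x
  exact oneGate_mulVec _ _ _ _ _

/-- The gate that changes the basis of the qubit `a`, controlled by the input `κ a` if there is
one. -/
noncomputable def basisGate [DecidableEq Q]
    (e : ι ⊕ o ≃ Q) (κ : o → Option ι) (a : o) : QGate Q :=
  match κ a with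
  | none => oneGate (e (Sum.inr a)) hadamard hadamard_unitary
  | some i => ctrlGate (e (Sum.inl i)) (e (Sum.inr a)) (by simp)
      (fun b => if b then yGate else hadamard) measureOp_unitary

theorem basisGate_support [DecidableEq Q]
    (e : ι ⊕ o ≃ Q) (κ : o → Option ι) (a : o) {q : Q}
    (hq : q ∈ (basisGate e κ a).support) :
    q = e (Sum.inr a) ∨ ∃ i, κ a = some i ∧ q = e (Sum.inl i) := by
  unfold basisGate at hq
  split at hq
  · exact Or.inl (by simpa [oneGate, targetGate] using hq)
  · rename_i i h
    rcases (by simpa [ctrlGate, targetGate] using hq : q = e (Sum.inl i) ∨ q = e (Sum.inr a))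
      with h1 | h1
    · exact Or.inr ⟨i, h, h1⟩
    · exact Or.inl h1

theorem basisGate_card_le [DecidableEq Q]
    (e : ι ⊕ o ≃ Q) (κ : o → Option ι) (a : o) :
    (basisGate e κ a).support.card ≤ 2 := by
  unfold basisGate
  split
  · simp [oneGate, targetGate]
  · exact Finset.card_le_two

/-- The basis changes on all output qubits. -/
noncomputable def basisLayer [Fintype o] [DecidableEq Q]
    (e : ι ⊕ o ≃ Q) (κ : o → Option ι)
    (hκ : ∀ a b i, κ a = some i → κ b = some i → a = b) : QLayer Q where
  gates := (Finset.univ : Finset o).toList.map (basisGate e κ)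
  disjoint := by
    rw [List.pairwise_map]
    refine (Finset.nodup_toList _).imp fun {a b} hab => ?_
    rw [Finset.disjoint_left]
    intro q ha hb
    rcases basisGate_support e κ a ha with h | ⟨i, hi, h⟩ <;>
      rcases basisGate_support e κ b hb with h' | ⟨j, hj, h'⟩ <;>
      have h3 := e.injective (h.symm.trans h')
    · exact hab (Sum.inr_injective h3)
    · cases h3
    · cases h3
    -- Each input controls at most one gate, so all controlled basis changes fit into a single
    -- layer.
    · have := Sum.inl_injective h3
      subst this
      exact hab (hκ a b i hi hj)

theorem basisLayer_mulVec [Fintype ι] [Fintype o] [Fintype Q] [DecidableEq o] [DecidableEq Q]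
    (e : ι ⊕ o ≃ Q) (κ : o → Option ι)
    (hκ : ∀ a b i, κ a = some i → κ b = some i → a = b) (A : ι → Bool) (f : o → Bool)
    (hf : ∀ a, f a = (κ a).elim false A) (φ : (o → Bool) → ℂ) :
    (basisLayer e κ hκ).toMatrix.mulVec (embedState e A φ) =
      embedState e A ((tensorOp fun a => if f a then yGate else hadamard).mulVec φ) := by
  rw [← foldr_localOp]
  refine foldr_embedState e A _ (fun a => localOp (if f a then yGate else hadamard) a)
    (fun a φ => ?_) _ φ
  rw [basisGate]
  split
  · rename_i h
    have hfa : f a = false := by rw [hf, h]; rfl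
    rw [← embedState_localOp e A a (fun _ => hadamard) _ fun _ _ => by simp [hfa]]
    funext x
    exact oneGate_mulVec _ _ _ _ _
  · rename_i i h
    have hfa : f a = A i := by rw [hf, h]; rfl
    rw [← embedState_localOp e A a
      (fun x => if x (e (Sum.inl i)) then yGate else hadamard) _ fun x hx => by rw [hx, hfa]]
    funext x
    exact ctrlGate_mulVec _ _ _ _ _ _ _

/-- Controlled-`Z` gates on disjoint pairs of output qubits. -/
noncomputable def czLayer {κ : Type} [DecidableEq Q]
    (e : ι ⊕ o ≃ Q) (s : Finset κ) (p q : κ → o)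
    (hpq : ∀ k, p k ≠ q k)
    (hdisj : ∀ k ∈ s, ∀ k' ∈ s, k ≠ k' → p k ≠ p k' ∧ p k ≠ q k' ∧ q k ≠ p k' ∧ q k ≠ q k') :
    QLayer Q where
  gates := s.toList.map fun k => ctrlGate (e (Sum.inr (p k))) (e (Sum.inr (q k)))
    (by simpa using hpq k) czBlock czBlock_unitary
  disjoint := by
    rw [List.pairwise_map]
    refine List.Pairwise.imp_of_mem (fun {k k'} hk hk' hne => ?_) (Finset.nodup_toList s)
    obtain ⟨h1, h2, h3, h4⟩ := hdisj k (Finset.mem_toList.mp hk) k' (Finset.mem_toList.mp hk') hne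
    simp [ctrlGate, targetGate, h1.symm, h2.symm, h3.symm, h4.symm]

theorem czLayer_mulVec {κ : Type} [Fintype ι] [Fintype o] [Fintype Q] [DecidableEq o] [DecidableEq Q]
    (e : ι ⊕ o ≃ Q) (s : Finset κ) (p q : κ → o)
    (hpq : ∀ k, p k ≠ q k)
    (hdisj : ∀ k ∈ s, ∀ k' ∈ s, k ≠ k' → p k ≠ p k' ∧ p k ≠ q k' ∧ q k ≠ p k' ∧ q k ≠ q k')
    (A : ι → Bool) (φ : (o → Bool) → ℂ) :
    (czLayer e s p q hpq hdisj).toMatrix.mulVec (embedState e A φ) =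
      embedState e A fun z => (∏ k ∈ s, czPhase s(p k, q k) z) * φ z := by
  have h := foldr_embedState e A
    (fun k => ctrlGate (e (Sum.inr (p k))) (e (Sum.inr (q k))) (by simpa using hpq k) czBlock
      czBlock_unitary)
    (fun k ψ z => czPhase s(p k, q k) z * ψ z) (fun k φ => ?_) s.toList φ
  · rw [foldr_mul_phase (fun k z => czPhase s(p k, q k) z)] at h
    refine h.trans ?_
    congr 1
    funext z
    rw [Finset.prod_map_toList]
  · funext x
    rw [czGate_mulVec]
    simp [embedState, czPhase]

end Embedded

section Construction

/-- Graph states of extended graphs of graphs with boundedly many displacements between adjacent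
vertices are measured by quantum circuits of constant depth. -/
theorem exists_quantum_circuit {ι V : Type} [Fintype ι] [Fintype V] [DecidableEq ι] [DecidableEq V]
    (G : SimpleGraph V) [DecidableRel G.Adj] (pos : V → ℤ × ℤ) (hpos : Function.Injective pos)
    (D : Finset (ℤ × ℤ)) (hD : ∀ v w, G.Adj v w → pos w - pos v ∈ D)
    (κ : V ⊕ G.edgeSet → Option ι) (hκ : ∀ a b i, κ a = some i → κ b = some i → a = b) :
    ∃ C : QCircuit ι (V ⊕ G.edgeSet), C.depth ≤ D.card + 2 ∧ C.FaninLE 2 ∧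
      ∀ (A : ι → Bool) (f : V ⊕ G.edgeSet → Bool), (∀ a, f a = (κ a).elim false A) →
        C.prob A {z | 0 < measureProb (graphState (extendedGraph G)) f z} = 1 := by
  classical
  let N := Fintype.card (ι ⊕ (V ⊕ G.edgeSet))
  let e : ι ⊕ (V ⊕ G.edgeSet) ≃ Fin N := Fintype.equivFin _
  let I := {p : G.edgeSet × V // p.2 ∈ p.1.1}
  let far : I → V := fun p => Sym2.Mem.other p.2
  have hfar : ∀ p : I, s(p.1.2, far p) = p.1.1.1 := fun p => Sym2.other_spec p.2
  have hadj : ∀ p : I, G.Adj p.1.2 (far p) := fun p => by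
    rw [← SimpleGraph.mem_edgeSet, hfar]
    exact p.1.1.2
  -- The two halves of an original edge receive opposite colours.
  let col : I → ℤ × ℤ := fun p => pos (far p) - pos p.1.2
  have hcol : ∀ p, col p ∈ D := fun p => hD _ _ (hadj p)
  have hsame : ∀ p p' : I, col p = col p' → p.1.2 = p'.1.2 → p = p' := by
    intro p p' hc hv
    have h1 : far p = far p' := by
      apply hpos
      have hc' : pos (far p) - pos p.1.2 = pos (far p') - pos p'.1.2 := hc
      rw [hv] at hc'
      exact sub_left_injective hc'
    apply Subtype.ext
    apply Prod.ext _ hv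
    apply Subtype.ext
    rw [← hfar p, ← hfar p', h1, hv]
  -- Different halves of one edge with equal colour would force the displacement to equal its own
  -- negative, so the endpoints would coincide.
  have hedge : ∀ p p' : I, col p = col p' → p.1.1 = p'.1.1 → p = p' := by
    intro p p' hc he
    apply hsame p p' hc
    have h1 : s(p.1.2, far p) = s(p'.1.2, far p') := by rw [hfar, hfar, he]
    rcases Sym2.eq_iff.mp h1 with ⟨h, _⟩ | ⟨h2, h3⟩
    · exact h
    · exfalso
      have hc' : pos (far p) - pos p.1.2 = pos (far p') - pos p'.1.2 := hc
      rw [h2, h3] at hc'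
      have h4 : pos p'.1.2 = pos (far p') := by
        have h5 := congrArg Prod.fst hc'
        have h6 := congrArg Prod.snd hc'
        simp only [Prod.fst_sub, Prod.snd_sub] at h5 h6
        exact Prod.ext (by omega) (by omega)
      exact (hadj p').ne (hpos h4)
  let L : ℤ × ℤ → QLayer (Fin N) := fun c => czLayer e (Finset.univ.filter fun p : I => col p = c)
    (fun p => Sum.inl p.1.2) (fun p => Sum.inr p.1.1) (fun _ => Sum.inl_ne_inr) (by
      intro p hp p' hp' hne
      have hc := (Finset.mem_filter.mp hp).2.trans (Finset.mem_filter.mp hp').2.symm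
      exact ⟨fun h => hne (hsame p p' hc (Sum.inl_injective h)), Sum.inl_ne_inr, Sum.inr_ne_inl,
        fun h => hne (hedge p p' hc (Sum.inr_injective h))⟩)
  let C : QCircuit ι (V ⊕ G.edgeSet) :=
    { width := N
      input := ⟨fun i => e (Sum.inl i), fun i j h => Sum.inl_injective (e.injective h)⟩
      output := ⟨fun a => e (Sum.inr a), fun a b h => Sum.inr_injective (e.injective h)⟩
      layers := hadamardLayer e :: (D.toList.map L ++ [basisLayer e κ hκ]) }
  refine ⟨C, ?_, ?_, ?_⟩
  · simp [QCircuit.depth, C]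
  · intro l hl g hg
    simp only [C, List.mem_cons, List.mem_append, List.mem_map, List.not_mem_nil, or_false] at hl
    rcases hl with rfl | ⟨c, _, rfl⟩ | rfl
    · obtain ⟨a, _, rfl⟩ := List.mem_map.mp hg
      simp [oneGate, targetGate]
    · obtain ⟨a, _, rfl⟩ := List.mem_map.mp hg
      exact Finset.card_le_two
    · obtain ⟨a, _, rfl⟩ := List.mem_map.mp hg
      exact basisGate_card_le e κ a
  · intro A f hf
    have hfinal : C.final A = embedState e A
        ((tensorOp fun a => if f a then yGate else hadamard).mulVec
          (graphState (extendedGraph G))) := by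
      have hinit : ket (C.initial A) = embedState e A (ket fun _ => false) := by
        apply embedState_ket
        · intro i
          have h : ∃ j, C.input j = e (Sum.inl i) := ⟨i, rfl⟩
          rw [QCircuit.initial, dif_pos h]
          exact congrArg A (C.input.injective h.choose_spec)
        · intro a
          rw [QCircuit.initial, dif_neg]
          rintro ⟨j, hj⟩
          exact Sum.inl_ne_inr (e.injective hj)
      rw [QCircuit.final, hinit]
      simp only [C, List.foldl_cons, List.foldl_append, List.foldl_nil]
      rw [hadamardLayer_mulVec, foldl_mul_phase e A L
        (fun c z => ∏ p ∈ Finset.univ.filter (fun p : I => col p = c),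
          czPhase s(Sum.inl p.1.2, Sum.inr p.1.1) z) (fun c φ => czLayer_mulVec e _ _ _ _ _ A φ),
        basisLayer_mulVec e κ hκ A f hf]
      congr 2
      funext z
      -- The colour classes partition the incident pairs, so the phases of the layers multiply to
      -- the full Controlled-$Z$ phase.
      rw [graphState, Matrix.mulVec_diagonal, Finset.prod_map_toList,
        Finset.prod_fiberwise_of_maps_to (fun p _ => hcol p), prod_extendedGraph_edges]
      congr 1
      exact (Finset.prod_subtype _ (by simp) fun p : G.edgeSet × V =>
        czPhase s(Sum.inl p.2, Sum.inr p.1) z).symm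
    have hsum := sum_norm_sq_embedState e A
      ((tensorOp fun a => if f a then yGate else hadamard).mulVec (graphState (extendedGraph G)))
    rw [QCircuit.prob, hfinal]
    -- Basis states outside the event contribute zero: their output has zero probability or their
    -- input register differs from `A`. The restricted sum is therefore the whole squared norm.
    refine Eq.trans (Finset.sum_congr rfl fun y _ => ?_)
      (hsum.trans (sum_measureProb_graphState (extendedGraph G) f))
    split_ifs with h
    · rfl
    · rw [embedState]
      split_ifs with h2
      · refine le_antisymm (sq_nonneg _) (not_lt.mp h)
      · simp

end Construction

/-- The relation is computed with certainty by quantum circuits of constant depth. -/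
theorem quantum_upper_bound (d : ℕ) :
    ∃ C : QCircuit (InIdx d) (OutIdx d), C.depth ≤ 27 ∧ C.FaninLE 2 ∧
      ∀ A : InIdx d → Bool, C.prob A (answers (rel d) A) = 1 := by
  -- Control vertices have their basis selected by their own input bit; all other outputs are always
  -- measured in the $X$-basis.
  let κ : OutIdx d → Option (InIdx d)
    | Sum.inl (Sum.inr u) => some u
    | _ => none
  obtain ⟨C, h1, h2, h3⟩ := exists_quantum_circuit (gridGraph d) (vertexPos d)
    (vertexPos_injective d) displacements (fun _ _ => vertexPos_sub_mem_displacements) κ (by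
      rintro ((a | a) | a) ((b | b) | b) i ha hb <;> simp_all [κ])
  refine ⟨C, by rwa [card_displacements] at h1, h2, fun A => h3 A (basisChoice d A) ?_⟩
  rintro ((a | a) | a) <;> rfl

end ShallowCircuits

open ShallowCircuits
theorem theorem2 :
    (∃ D : ℕ, ∀ d : ℕ, 0 < d → Even d →
      ∃ C : QCircuit (InIdx d) (OutIdx d), C.depth ≤ D ∧ C.FaninLE 2 ∧
        ∀ A : InIdx d → Bool, C.prob A (answers (rel d) A) = 1) ∧
    (∃ d₀ : ℕ, ∀ d : ℕ, d₀ ≤ d → 0 < d → Even d → ∀ K : ℕ, 2 ≤ K →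
      ∀ C : RandCircuit (InIdx d) (OutIdx d), C.circuit.FaninLE K →
        (C.circuit.depth : ℝ) ≤ 1 / 8 * Real.logb K ((ctrlSide d ^ 2 : ℕ) : ℝ) →
        1 / (2 : ℝ) ^ (ctrlSide d ^ 2) *
          ∑ A : InIdx d → Bool, C.prob A (answers (rel d) A) < 15 / 16) :=
  ⟨⟨27, fun d _ _ => quantum_upper_bound d⟩,
    ⟨1000, fun d hd _ _ K hK C hC hdepth => classical_lower_bound d hd K hK C hC hdepth⟩⟩
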